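/- Let $n\ge 1$, let $A:[0,1]\to\mathbb R^{n\times n}$ and $\vec f:[0,1]\to\mathbb R^n$ have twice continuously differentiable components, let $\vec u_0,\vec u_1\in\mathbb R^n$ and $\alpha>0$, and suppose that for all $x\in[0,1]$ and $1\le i\le n$ $$a_{ii}(x)>\sum_{j\ne i}|a_{ij}(x)|,\qquad a_{ij}(x)\le 0\ \ (j\neq i),\qquad \alpha<\sum_{j=1}^n a_{ij}(x).$$ Then there is a constant $C>0$, which may depend on $n,A,\vec f,\vec u_0,\vec u_1,\alpha$ only, such that the following holds for all parameters $0<\varepsilon_1<\dots<\varepsilon_n\le 1$ and all integers $N>1$ divisible by $2^{n+1}$. Let $E=\operatorname{diag}(\varepsilon_1,\dots,\varepsilon_n)$ and let $\vec u\in C([0,1])\cap C^2((0,1))$ be the solution of $$-E\vec u''(x)+A(x)\vec u(x)=\vec f(x),\quad x\in(0,1),\qquad \vec u(0)=\vec u_0,\quad \vec u(1)=\vec u_1 .$$ Define the transition points $\sigma_n=\min\{\tfrac14,\sqrt{\varepsilon_n/\alpha}\,\ln N\}$ and $\sigma_i=\min\{\tfrac12\sigma_{i+1},\sqrt{\varepsilon_i/\alpha}\,\ln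 N\}$ for $i=n-1,\dots,1$. Let $0=x_0<x_1<\dots<x_N=1$ be the piecewise-uniform Shishkin mesh, obtained by dividing $[\sigma_n,1-\sigma_n]$ into $N/2$ equal mesh-intervals, each of $[\sigma_i,\sigma_{i+1}]$ and $[1-\sigma_{i+1},1-\sigma_i]$, $1\le i\le n-1$, into $N/2^{n-i+2}$ equal mesh-intervals, and each of $[0,\sigma_1]$ and $[1-\sigma_1,1]$ into $N/2^{n+1}$ equal mesh-intervals. Let $(\vec U_j)_{j=0}^N$ be the solution of the central difference scheme $$-E\,\delta^2\vec U_j+A(x_j)\vec U_j=\vec f(x_j),\quad 1\le j\le N-1,\qquad \vec U_0=\vec u_0,\quad \vec U_N=\vec u_1,$$ where, with $h_j=x_j-x_{j-1}$, $$\delta^2\vec U_j=\frac{2}{h_j+h_{j+1}}\left(\frac{\vec U_{j+1}-\vec U_j}{h_{j+1}}-\frac{\vec U_j-\vec U_{j-1}}{h_j}\right).$$ Then $$\max_{0\le j\le N}\ \max_{1\le i\le n}\,|U_{j,i}-u_i(x_j)|\le C\,N^{-1}\ln N .$$ -/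

import Mathlib

noncomputable section

namespace ReactionDiffusion

open Set

/-- `u` is a classical solution, continuous on `[0,1]` and `C²` on `(0,1)`, of
`-E u'' + A u = f` in `(0,1)`, `u(0) = u₀`, `u(1) = u₁`, where `E = diag(ε)`. -/
structure IsSolution {n : ℕ} (ε : Fin n → ℝ) (A : ℝ → Matrix (Fin n) (Fin n) ℝ)
    (f : ℝ → Fin n → ℝ) (u₀ u₁ : Fin n → ℝ) (u : ℝ → Fin n → ℝ) : Prop where
  continuousOn : ContinuousOn u (Icc 0 1)
  contDiffOn : ContDiffOn ℝ 2 u (Ioo 0 1)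
  eqn : ∀ x ∈ Ioo (0 : ℝ) 1, ∀ i,
    -(ε i) * iteratedDeriv 2 (fun y => u y i) x + (A x).mulVec (u x) i = f x i
  left : u 0 = u₀
  right : u 1 = u₁

/-- The transition parameters. In code the indices run over `0, …, n-1`, so that `transition ε α N i`
is `σ_{i+1}`. The value `1/2` beyond the last index makes the top parameter
`σ_n = min {1/4, √(ε_n/α) ln N}`, while the others are `σ_i = min {σ_{i+1}/2, √(ε_i/α) ln N}`. -/
def transition {n : ℕ} (ε : Fin n → ℝ) (α : ℝ) (N : ℕ) (i : ℕ) : ℝ :=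
  if h : i < n then
    min (transition ε α N (i + 1) / 2) (Real.sqrt (ε ⟨i, h⟩ / α) * Real.log N)
  else 1 / 2
termination_by n - i

/-- The endpoints `0, σ_1, …, σ_n, 1 - σ_n, …, 1 - σ_1, 1` (numbered `0, …, 2n+1`) of the `2n+1`
subintervals of `[0,1]`. -/
def breakpoint {n : ℕ} (ε : Fin n → ℝ) (α : ℝ) (N : ℕ) : ℕ → ℝ
  | 0 => 0
  | k + 1 =>
    if k < n then transition ε α N k
    else if k < 2 * n then 1 - transition ε α N (2 * n - 1 - k)
    else 1

/-- The number of mesh-intervals placed on the `k`-th subinterval, `k = 0, …, 2n`: `N/2` on the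
central one, `N/2^{n+1}` on the two extreme ones, and `N/2^{n-k+2}` on the subinterval between
`σ_k` and `σ_{k+1}` and on its mirror image. -/
def meshCount (n N k : ℕ) : ℕ :=
  if k = n then N / 2
  else if k = 0 ∨ k = 2 * n then N / 2 ^ (n + 1)
  else if k < n then N / 2 ^ (n - k + 2)
  else N / 2 ^ (k - n + 2)

/-- The number of mesh-intervals placed to the left of the `k`-th subinterval. -/
def meshOffset (n N k : ℕ) : ℕ := ∑ r ∈ Finset.range k, meshCount n N r

/-- The points `x_j`, `0 ≤ j ≤ N`, of the piecewise-uniform mesh. Among the first `j` mesh-intervals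
exactly `min (j - meshOffset n N k) (meshCount n N k)` lie in the `k`-th subinterval, and each of
these has the length of that subinterval divided by `meshCount n N k`. -/
def meshPoint {n : ℕ} (ε : Fin n → ℝ) (α : ℝ) (N j : ℕ) : ℝ :=
  ∑ k ∈ Finset.range (2 * n + 1),
    ((min (j - meshOffset n N k) (meshCount n N k) : ℕ) : ℝ) *
      ((breakpoint ε α N (k + 1) - breakpoint ε α N k) / (meshCount n N k : ℝ))

/-- The second order difference operator `δ²` on the mesh `x`, at an interior mesh point `x_j`:
`δ² U_j = (D⁺ U_j - D⁻ U_j) / ((h_j + h_{j+1}) / 2)`, where `h_j = x_j - x_{j-1}`. -/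
def secondDiff (x : ℕ → ℝ) (U : ℕ → ℝ) (j : ℕ) : ℝ :=
  ((U (j + 1) - U j) / (x (j + 1) - x j) - (U j - U (j - 1)) / (x j - x (j - 1))) /
    (((x j - x (j - 1)) + (x (j + 1) - x j)) / 2)

/-- The mesh function `U_0, …, U_N` solves `-E δ² U + A U = f` at the interior points of the mesh
`x_0, …, x_N`, with `U_0 = u₀`, `U_N = u₁`. -/
structure IsDiscreteSolution {n : ℕ} (ε : Fin n → ℝ) (A : ℝ → Matrix (Fin n) (Fin n) ℝ)
    (f : ℝ → Fin n → ℝ) (u₀ u₁ : Fin n → ℝ) (N : ℕ) (x : ℕ → ℝ) (U : ℕ → Fin n → ℝ) : Prop where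
  eqn : ∀ j, 0 < j → j < N → ∀ i,
    -(ε i) * secondDiff x (fun l => U l i) j + (A (x j)).mulVec (U j) i = f (x j) i
  left : U 0 = u₀
  right : U N = u₁

/-- On every subinterval the mesh points are equally spaced, from one endpoint to the other. -/
theorem meshPoint_offset_add {n : ℕ} (ε : Fin n → ℝ) (α : ℝ) (N k l : ℕ) (hk : k ≤ 2 * n)
    (hpos : ∀ r ≤ 2 * n, 0 < meshCount n N r) (hl : l ≤ meshCount n N k) :
    meshPoint ε α N (meshOffset n N k + l) = breakpoint ε α N k +
      l * ((breakpoint ε α N (k + 1) - breakpoint ε α N k) / (meshCount n N k : ℝ)) := by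
  have hmono : Monotone (meshOffset n N) := fun a b hab =>
    Finset.sum_le_sum_of_subset (Finset.range_mono hab)
  have hsucc : ∀ r, meshOffset n N (r + 1) = meshOffset n N r + meshCount n N r := fun r =>
    Finset.sum_range_succ _ _
  unfold meshPoint
  rw [← Finset.sum_range_add_sum_Ico _ (show k + 1 ≤ 2 * n + 1 by omega),
    Finset.sum_range_succ]
  have h1 : ∀ r ∈ Finset.range k,
      ((min (meshOffset n N k + l - meshOffset n N r) (meshCount n N r) : ℕ) : ℝ) *
        ((breakpoint ε α N (r + 1) - breakpoint ε α N r) / (meshCount n N r : ℝ)) =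
      breakpoint ε α N (r + 1) - breakpoint ε α N r := by
    intro r hr
    have hr := Finset.mem_range.1 hr
    have h2 := hmono (show r + 1 ≤ k from hr)
    rw [hsucc] at h2
    have h3 : (meshCount n N r : ℝ) ≠ 0 := by
      exact_mod_cast (hpos r (by omega)).ne'
    rw [min_eq_right (by omega)]
    field_simp
  have h4 : ∀ r ∈ Finset.Ico (k + 1) (2 * n + 1),
      ((min (meshOffset n N k + l - meshOffset n N r) (meshCount n N r) : ℕ) : ℝ) *
        ((breakpoint ε α N (r + 1) - breakpoint ε α N r) / (meshCount n N r : ℝ)) = 0 := by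
    intro r hr
    have h2 := hmono (Finset.mem_Ico.1 hr).1
    rw [hsucc] at h2
    rw [show meshOffset n N k + l - meshOffset n N r = 0 by omega]
    simp
  rw [Finset.sum_congr rfl h1, Finset.sum_eq_zero h4, Finset.sum_range_sub,
    show meshOffset n N k + l - meshOffset n N k = l by omega, min_eq_left hl]
  simp [breakpoint]

end ReactionDiffusion

end

/-! The scheme is stable in the maximum norm: at a positive maximum of the error the M-matrix row
gives `α * e ≤ τ` (`discrete_stability`), so the truncation error has to be `O(N⁻¹ ln N)`. By Rolle,
`δ² u_i` at a mesh point equals `u_i''(ξ)` for some `ξ` in the two adjacent cells. The truncation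
error is therefore `ε_i (u_i''(ξ) - u_i''(x_k))`, and the differential equation rewrites it as the
difference of the `i`-th component of `A u - f` between `ξ` and `x_k`
(`IsClassical.abs_reaction_sub_le`). Hence no third derivative and no decomposition into regular and
singular parts is needed: it suffices to bound the oscillation of `u` over one cell.

With `s_m = √(ε_m/α)`, every `|u_i'|` is at most a constant plus a fixed combination of `s_m⁻¹
(exp(-x/s_m) + exp(-(1-x)/s_m))` (`IsClassical.abs_deriv_le_layer`). Each of these layer terms has a
bounded integral. Over one cell it contributes `O(N⁻¹)` if the cell lies at distance at least `s_m
ln N` from the endpoint, and otherwise `O(N⁻¹ ln N)`, because the cell is then short compared with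
`s_m` (`mesh_interval`).

The derivative bound comes from the maximum principle applied to the increments `u(x+h) - u(x)`,
with end values of order `h/s_i` supplied by a crude interpolation estimate. The barrier needs care.
Layers with `m ≥ i` can enter row `i` with coefficient `K_m/s_m`, since there `ε_i/s_m² ≤ α` is
beaten by the row sum. A faster layer, `m < i`, would have a large negative image under the
operator, so it enters with a small negative coefficient. The resulting defects are absorbed by the
`i`-th layer if the weights `K_m` grow geometrically (`barrier_supersolution`). -/

noncomputable section

namespace ReactionDiffusion

open Set Filter Topology

/-! ### Calculus on an interval -/

/-- The second derivative is nonnegative at a local minimum. -/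
theorem second_deriv_nonneg_of_isLocalMin {g g₁ : ℝ → ℝ} {x d : ℝ} (hmin : IsLocalMin g x)
    (h₁ : ∀ᶠ y in 𝓝 x, HasDerivAt g (g₁ y) y) (h₂ : HasDerivAt g₁ d x) : 0 ≤ d := by
  by_contra! hd
  have hev : deriv g =ᶠ[𝓝 x] g₁ := h₁.mono fun y hy => hy.deriv
  have hdd : deriv (deriv g) x = d := hev.deriv_eq.trans h₂.deriv
  -- A negative second derivative would make the minimum a maximum as well, so `g` would be locally
  -- constant.
  have hmax : IsLocalMax g x := isLocalMax_of_deriv_deriv_neg (hdd ▸ hd) hmin.deriv_eq_zero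
    h₁.self_of_nhds.continuousAt
  have hconst : g =ᶠ[𝓝 x] fun _ => g x := by
    filter_upwards [hmin, hmax] with y h h' using le_antisymm h' h
  have h0 : deriv g =ᶠ[𝓝 x] fun _ => (0 : ℝ) := by
    filter_upwards [hconst.eventuallyEq_nhds] with y hy
    rw [hy.deriv_eq, deriv_const]
  rw [← hdd, h0.deriv_eq, deriv_const] at hd
  exact lt_irrefl _ hd

/-- The second divided difference is half the second derivative at an intermediate point. -/
theorem exists_divided_difference_eq {g g₁ g₂ : ℝ → ℝ} {a b c : ℝ} (hab : a < b) (hbc : b < c)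
    (hg : ContinuousOn g (Icc a c)) (h₁ : ∀ x ∈ Ioo a c, HasDerivAt g (g₁ x) x)
    (h₂ : ∀ x ∈ Ioo a c, HasDerivAt g₁ (g₂ x) x) :
    ∃ ξ ∈ Ioo a c, ((g c - g b) / (c - b) - (g b - g a) / (b - a)) /
      (((b - a) + (c - b)) / 2) = g₂ ξ := by
  set s := (g b - g a) / (b - a) with hs
  set t := ((g c - g b) / (c - b) - (g b - g a) / (b - a)) / (((b - a) + (c - b)) / 2) with ht
  have hba : b - a ≠ 0 := by linarith
  have hcb : c - b ≠ 0 := by linarith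
  have hca : c - a ≠ 0 := by linarith
  -- Subtract the quadratic interpolant at `a`, `b`, `c`, whose second derivative is `t`; the
  -- remainder has three zeros, and Rolle applies twice.
  let q : ℝ → ℝ := fun x => g x - (g a + s * (x - a) + t / 2 * ((x - a) * (x - b)))
  let q₁ : ℝ → ℝ := fun x => g₁ x - (s + t / 2 * ((x - a) + (x - b)))
  have hqc : ContinuousOn q (Icc a c) := hg.sub (by fun_prop)
  have hq : ∀ x ∈ Ioo a c, HasDerivAt q (q₁ x) x := by
    intro x hx
    have hxa := (hasDerivAt_id x).sub_const a
    have hxb := (hasDerivAt_id x).sub_const b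
    refine ((h₁ x hx).sub (((hxa.const_mul s).const_add (g a)).add
      ((hxa.mul hxb).const_mul (t / 2)))).congr_deriv ?_
    simp only [q₁, id]
    ring
  have hq₁ : ∀ x ∈ Ioo a c, HasDerivAt q₁ (g₂ x - t) x := by
    intro x hx
    have hxa := (hasDerivAt_id x).sub_const a
    have hxb := (hasDerivAt_id x).sub_const b
    refine ((h₂ x hx).sub (((hxa.add hxb).const_mul (t / 2)).const_add s)).congr_deriv ?_
    ring
  have hqa : q a = 0 := by simp [q]
  have hqb : q b = 0 := by
    simp only [q, hs]
    field_simp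
    ring
  have hqc' : q c = 0 := by
    simp only [q]
    have : t * (c - a) = 2 * ((g c - g b) / (c - b) - s) := by
      rw [ht, show (b - a) + (c - b) = c - a by ring, ← hs]
      field_simp
    have h3 : (g c - g b) / (c - b) * (c - b) = g c - g b := by field_simp
    have h4 : s * (b - a) = g b - g a := by rw [hs]; field_simp
    linear_combination (-(c - b) / 2) * this - h3 - h4
  obtain ⟨ξ₁, hξ₁, e₁⟩ := exists_hasDerivAt_eq_zero hab
    (hqc.mono (Icc_subset_Icc_right hbc.le)) (hqa.trans hqb.symm)
    fun x hx => hq x ⟨hx.1, hx.2.trans hbc⟩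
  obtain ⟨ξ₂, hξ₂, e₂⟩ := exists_hasDerivAt_eq_zero hbc
    (hqc.mono (Icc_subset_Icc_left hab.le)) (hqb.trans hqc'.symm)
    fun x hx => hq x ⟨hab.trans hx.1, hx.2⟩
  obtain ⟨ξ, hξ, e⟩ := exists_hasDerivAt_eq_zero (hξ₁.2.trans hξ₂.1)
    (fun x hx => (hq₁ x ⟨hξ₁.1.trans_le hx.1, hx.2.trans_lt hξ₂.2⟩).continuousAt.continuousWithinAt)
    (e₁.trans e₂.symm) fun x hx => hq₁ x ⟨hξ₁.1.trans hx.1, hx.2.trans hξ₂.2⟩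
  exact ⟨ξ, ⟨hξ₁.1.trans hξ.1, hξ.2.trans hξ₂.2⟩, by linarith⟩

/-- An interpolation inequality: bounds of a function and of its second derivative on the unit
interval bound the first derivative. -/
theorem abs_deriv_le_of_abs_second_deriv_le {g g₁ g₂ : ℝ → ℝ} {c₀ c₂ l : ℝ}
    (hg : ContinuousOn g (Icc 0 1)) (h₁ : ∀ x ∈ Ioo (0 : ℝ) 1, HasDerivAt g (g₁ x) x)
    (h₂ : ∀ x ∈ Ioo (0 : ℝ) 1, HasDerivAt g₁ (g₂ x) x) (hc₀ : ∀ x ∈ Icc (0 : ℝ) 1, |g x| ≤ c₀)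
    (hc₂ : ∀ x ∈ Ioo (0 : ℝ) 1, |g₂ x| ≤ c₂) (hl : 0 < l) (hl' : l ≤ 1 / 2) {x : ℝ}
    (hx : x ∈ Ioo (0 : ℝ) 1) : |g₁ x| ≤ 2 * c₀ / l + c₂ * l := by
  have key : ∀ a b : ℝ, a < b → 0 ≤ a → b ≤ 1 → b - a = l →
      ∃ ξ ∈ Ioo a b, |g₁ ξ| ≤ 2 * c₀ / l := by
    intro a b hab ha hb hl
    obtain ⟨ξ, hξ, e⟩ := exists_hasDerivAt_eq_slope g g₁ hab
      (hg.mono (Icc_subset_Icc ha hb)) fun y hy => h₁ y ⟨ha.trans_lt hy.1, hy.2.trans_le hb⟩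
    refine ⟨ξ, hξ, ?_⟩
    rw [e, hl, abs_div, abs_of_pos ‹0 < l›]
    have h3 := hc₀ a ⟨ha, hab.le.trans hb⟩
    have h4 := hc₀ b ⟨ha.trans hab.le, hb⟩
    gcongr
    linarith [abs_sub (g b) (g a)]
  -- Apply the mean value theorem on an interval of length `l` with `x` as an endpoint, on the side
  -- where it fits because `l ≤ 1/2`.
  obtain ⟨ξ, hξ, hξx, hb⟩ : ∃ ξ ∈ Ioo (0 : ℝ) 1, |x - ξ| ≤ l ∧ |g₁ ξ| ≤ 2 * c₀ / l := by
    rcases le_total x (1 / 2) with h | h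
    · obtain ⟨ξ, hξ, hb⟩ := key x (x + l) (by linarith) hx.1.le (by linarith) (by ring)
      exact ⟨ξ, ⟨hx.1.trans hξ.1, by linarith [hξ.2]⟩,
        abs_le.2 ⟨by linarith [hξ.2], by linarith [hξ.1]⟩, hb⟩
    · obtain ⟨ξ, hξ, hb⟩ := key (x - l) x (by linarith) (by linarith) hx.2.le (by ring)
      exact ⟨ξ, ⟨by linarith [hξ.1], hξ.2.trans hx.2⟩,
        abs_le.2 ⟨by linarith [hξ.2], by linarith [hξ.1]⟩, hb⟩
  have h3 := (convex_Ioo (0 : ℝ) 1).norm_image_sub_le_of_norm_hasDerivWithin_le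
    (fun y hy => (h₂ y hy).hasDerivWithinAt) (fun y hy => hc₂ y hy) hξ hx
  simp only [Real.norm_eq_abs] at h3
  have hc : 0 ≤ c₂ := (abs_nonneg _).trans (hc₂ x hx)
  have h4 : c₂ * |x - ξ| ≤ c₂ * l := by gcongr
  linarith [abs_sub_abs_le_abs_sub (g₁ x) (g₁ ξ)]

/-! ### Maximum principles -/

/-- If an M-matrix row is applied to a vector whose smallest entry is the diagonal one, the
result is at most the row sum times this entry. -/
theorem sum_mul_le_of_forall_ge {n : ℕ} {M : Fin n → ℝ} {i : Fin n} (hoff : ∀ j, i ≠ j → M j ≤ 0)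
    {w : Fin n → ℝ} (hw : ∀ j, w i ≤ w j) : ∑ j, M j * w j ≤ (∑ j, M j) * w i := by
  rw [Finset.sum_mul]
  refine Finset.sum_le_sum fun j _ => ?_
  rcases eq_or_ne i j with rfl | h
  · exact le_rfl
  · exact mul_le_mul_of_nonpos_left (hw j) (hoff j h)

/-- The maximum principle for weakly coupled systems. -/
theorem nonneg_of_supersolution {n : ℕ} {ε : Fin n → ℝ} (hε : ∀ i, 0 < ε i) {a b : ℝ}
    (hab : a ≤ b) {M : ℝ → Matrix (Fin n) (Fin n) ℝ}
    (hoff : ∀ x ∈ Ioo a b, ∀ i j, i ≠ j → M x i j ≤ 0)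
    (hrow : ∀ x ∈ Ioo a b, ∀ i, 0 < ∑ j, M x i j) {w w₁ w₂ : Fin n → ℝ → ℝ}
    (hc : ∀ i, ContinuousOn (w i) (Icc a b))
    (h₁ : ∀ i, ∀ x ∈ Ioo a b, HasDerivAt (w i) (w₁ i x) x)
    (h₂ : ∀ i, ∀ x ∈ Ioo a b, HasDerivAt (w₁ i) (w₂ i x) x)
    (ha : ∀ i, 0 ≤ w i a) (hb : ∀ i, 0 ≤ w i b)
    (hL : ∀ x ∈ Ioo a b, ∀ i, 0 ≤ -(ε i) * w₂ i x + ∑ j, M x i j * w j x) :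
    ∀ i, ∀ x ∈ Icc a b, 0 ≤ w i x := by
  intro i₀ x₀ hx₀
  choose y hy hmin using fun i => isCompact_Icc.exists_isMinOn (nonempty_Icc.2 hab) (hc i)
  have : Nonempty (Fin n) := ⟨i₀⟩
  obtain ⟨i, hi⟩ := Finite.exists_min fun i => w i (y i)
  have hall : ∀ j, ∀ x ∈ Icc a b, w i (y i) ≤ w j x := fun j x hx => (hi j).trans (hmin j hx)
  refine le_trans ?_ (hall i₀ x₀ hx₀)
  by_contra! hneg
  have hya : a ≠ y i := fun h => by have := ha i; rw [h] at this; linarith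
  have hyb : y i ≠ b := fun h => by have := hb i; rw [← h] at this; linarith
  have hyI : y i ∈ Ioo a b := ⟨lt_of_le_of_ne (hy i).1 hya, lt_of_le_of_ne (hy i).2 hyb⟩
  have hnhds : Ioo a b ∈ 𝓝 (y i) := isOpen_Ioo.mem_nhds hyI
  have hd : 0 ≤ w₂ i (y i) := second_deriv_nonneg_of_isLocalMin
    (Filter.mem_of_superset hnhds fun x hx => hall i x (Ioo_subset_Icc_self hx))
    (Filter.mem_of_superset hnhds fun x hx => h₁ i x hx) (h₂ i _ hyI)
  have h3 := hL _ hyI i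
  have h4 := sum_mul_le_of_forall_ge (w := fun j => w j (y i)) (hoff _ hyI i)
    fun j => hall j _ (hy i)
  have h5 := mul_neg_of_pos_of_neg (hrow _ hyI i) hneg
  have h6 := mul_nonneg (hε i).le hd
  linarith

theorem secondDiff_nonpos_of_isMax {x U : ℕ → ℝ} {j : ℕ} (hx : x (j - 1) < x j)
    (hx' : x j < x (j + 1)) (h : U (j - 1) ≤ U j) (h' : U (j + 1) ≤ U j) :
    secondDiff x U j ≤ 0 := by
  unfold secondDiff
  have h1 : (U (j + 1) - U j) / (x (j + 1) - x j) ≤ 0 :=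
    div_nonpos_of_nonpos_of_nonneg (by linarith) (by linarith)
  have h2 : 0 ≤ (U j - U (j - 1)) / (x j - x (j - 1)) := div_nonneg (by linarith) (by linarith)
  exact div_nonpos_of_nonpos_of_nonneg (by linarith) (by linarith)

/-- At the largest entry over all points and components, if it were positive, the second difference
would be nonpositive and the other components no larger, so `α` times this entry would be at most
`τ`. -/
theorem discrete_le {n : ℕ} {ε : Fin n → ℝ} (hε : ∀ i, 0 < ε i) {N : ℕ} {x : ℕ → ℝ}
    (hx : ∀ j < N, x j < x (j + 1)) {M : ℕ → Matrix (Fin n) (Fin n) ℝ} {α τ : ℝ} (hα : 0 < α)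
    (hτ : 0 ≤ τ) (hoff : ∀ k, 0 < k → k < N → ∀ i j, i ≠ j → M k i j ≤ 0)
    (hrow : ∀ k, 0 < k → k < N → ∀ i, α ≤ ∑ j, M k i j) {e : ℕ → Fin n → ℝ} (h0 : e 0 = 0)
    (hN : e N = 0)
    (hL : ∀ k, 0 < k → k < N → ∀ i,
      -(ε i) * secondDiff x (fun l => e l i) k + ∑ j, M k i j * e k j ≤ τ) :
    ∀ k ≤ N, ∀ i, e k i ≤ τ / α := by
  intro k₀ hk₀ i₀
  obtain ⟨⟨k, i⟩, hmem, hmax⟩ := Finset.exists_max_image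
    (Finset.range (N + 1) ×ˢ (Finset.univ : Finset (Fin n))) (fun p => e p.1 p.2)
    ⟨(k₀, i₀), by simp; omega⟩
  have hkN : k ≤ N := by simp at hmem; omega
  have hall : ∀ l ≤ N, ∀ j, e l j ≤ e k i := fun l hl j => hmax (l, j) (by simp; omega)
  refine (hall k₀ hk₀ i₀).trans ?_
  have hd : 0 ≤ τ / α := by positivity
  rcases Nat.eq_zero_or_pos k with rfl | hk
  · simpa [h0] using hd
  rcases hkN.eq_or_lt with rfl | hk'
  · simpa [hN] using hd
  by_contra! hlt
  have hpos : 0 < e k i := hd.trans_lt hlt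
  have hx1 := hx (k - 1) (by omega)
  rw [show k - 1 + 1 = k by omega] at hx1
  have h3 : secondDiff x (fun l => e l i) k ≤ 0 := secondDiff_nonpos_of_isMax hx1 (hx k hk')
    (hall _ (by omega) i) (hall _ (by omega) i)
  have h4 := sum_mul_le_of_forall_ge (w := fun j => -e k j) (hoff k hk hk' i)
    fun j => neg_le_neg (hall k hkN j)
  simp only [mul_neg, Finset.sum_neg_distrib] at h4
  have h5 := hL k hk hk' i
  have h6 := mul_le_mul_of_nonneg_right (hrow k hk hk' i) hpos.le
  rw [div_lt_iff₀ hα] at hlt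
  nlinarith [hε i]

/-- Stability of the difference scheme in the maximum norm. -/
theorem discrete_stability {n : ℕ} {ε : Fin n → ℝ} (hε : ∀ i, 0 < ε i) {N : ℕ} {x : ℕ → ℝ}
    (hx : ∀ j < N, x j < x (j + 1)) {M : ℕ → Matrix (Fin n) (Fin n) ℝ} {α τ : ℝ} (hα : 0 < α)
    (hτ : 0 ≤ τ) (hoff : ∀ k, 0 < k → k < N → ∀ i j, i ≠ j → M k i j ≤ 0)
    (hrow : ∀ k, 0 < k → k < N → ∀ i, α ≤ ∑ j, M k i j) {e : ℕ → Fin n → ℝ} (h0 : e 0 = 0)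
    (hN : e N = 0)
    (hL : ∀ k, 0 < k → k < N → ∀ i,
      |-(ε i) * secondDiff x (fun l => e l i) k + ∑ j, M k i j * e k j| ≤ τ) :
    ∀ k ≤ N, ∀ i, |e k i| ≤ τ / α := by
  intro k hk i
  refine abs_le.2 ⟨?_, discrete_le hε hx hα hτ hoff hrow h0 hN
    (fun k hk hk' i => (abs_le.1 (hL k hk hk' i)).2) k hk i⟩
  have := discrete_le hε hx hα hτ hoff hrow (e := -e) (by simp [h0]) (by simp [hN])
    (fun k hk hk' i => ?_) k hk i
  · simp only [Pi.neg_apply] at this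
    linarith
  · have h3 : secondDiff x (fun l => (-e) l i) k = -secondDiff x (fun l => e l i) k := by
      simp only [secondDiff, Pi.neg_apply]
      ring
    have h4 := (abs_le.1 (hL k hk hk' i)).1
    rw [h3]
    simp only [Pi.neg_apply, mul_neg, Finset.sum_neg_distrib]
    linarith

/-- A comparison principle: a supersolution bounds the absolute value. -/
theorem abs_le_of_barrier {n : ℕ} {ε : Fin n → ℝ} (hε : ∀ i, 0 < ε i) {a b : ℝ}
    (hab : a ≤ b) {M : ℝ → Matrix (Fin n) (Fin n) ℝ}
    (hoff : ∀ x ∈ Ioo a b, ∀ i j, i ≠ j → M x i j ≤ 0)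
    (hrow : ∀ x ∈ Ioo a b, ∀ i, 0 < ∑ j, M x i j) {v v₁ v₂ w w₁ w₂ : Fin n → ℝ → ℝ}
    (hv : ∀ i, ContinuousOn (v i) (Icc a b))
    (hv₁ : ∀ i, ∀ x ∈ Ioo a b, HasDerivAt (v i) (v₁ i x) x)
    (hv₂ : ∀ i, ∀ x ∈ Ioo a b, HasDerivAt (v₁ i) (v₂ i x) x)
    (hw : ∀ i, ContinuousOn (w i) (Icc a b))
    (hw₁ : ∀ i, ∀ x ∈ Ioo a b, HasDerivAt (w i) (w₁ i x) x)
    (hw₂ : ∀ i, ∀ x ∈ Ioo a b, HasDerivAt (w₁ i) (w₂ i x) x)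
    (ha : ∀ i, |v i a| ≤ w i a) (hb : ∀ i, |v i b| ≤ w i b)
    (hL : ∀ x ∈ Ioo a b, ∀ i, |-(ε i) * v₂ i x + ∑ j, M x i j * v j x| ≤
      -(ε i) * w₂ i x + ∑ j, M x i j * w j x) :
    ∀ i, ∀ x ∈ Icc a b, |v i x| ≤ w i x := by
  intro i x hx
  refine abs_le.2 ⟨?_, ?_⟩
  · have := nonneg_of_supersolution hε hab hoff hrow (w := fun i x => w i x + v i x)
      (fun i => (hw i).add (hv i)) (fun i x hx => (hw₁ i x hx).add (hv₁ i x hx))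
      (fun i x hx => (hw₂ i x hx).add (hv₂ i x hx))
      (fun i => by linarith [neg_abs_le (v i a), ha i])
      (fun i => by linarith [neg_abs_le (v i b), hb i]) (fun x hx i => ?_) i x hx
    · linarith
    · simp only [mul_add, Finset.sum_add_distrib]
      linarith [(abs_le.1 (hL x hx i)).1]
  · have := nonneg_of_supersolution hε hab hoff hrow (w := fun i x => w i x - v i x)
      (fun i => (hw i).sub (hv i)) (fun i x hx => (hw₁ i x hx).sub (hv₁ i x hx))
      (fun i x hx => (hw₂ i x hx).sub (hv₂ i x hx))
      (fun i => by linarith [le_abs_self (v i a), ha i])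
      (fun i => by linarith [le_abs_self (v i b), hb i]) (fun x hx i => ?_) i x hx
    · linarith
    · simp only [mul_sub, Finset.sum_sub_distrib]
      linarith [(abs_le.1 (hL x hx i)).2]

/-! ### The layer barrier -/

/-- Bookkeeping for sums over layers: keep the `i`-th term, accept losses from the faster layers,
drop the nonnegative slower ones. -/
theorem add_sum_Iio_le_sum {n : ℕ} {g r : Fin n → ℝ} {p : ℝ} {i : Fin n} (hi : p ≤ g i)
    (hlt : ∀ m < i, r m ≤ g m) (hgt : ∀ m, i < m → 0 ≤ g m) :
    p + ∑ m ∈ Finset.Iio i, r m ≤ ∑ m, g m := by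
  have h1 : p + ∑ m ∈ Finset.Iio i, r m =
      ∑ m, ((if m = i then p else 0) + if m < i then r m else 0) := by
    rw [Finset.sum_add_distrib, Finset.sum_ite_eq' Finset.univ i]
    simp only [Finset.mem_univ, if_true]
    rw [← Finset.sum_filter]
    congr 2
    ext m
    simp
  rw [h1]
  refine Finset.sum_le_sum fun m _ => ?_
  rcases lt_trichotomy m i with h | h | h
  · simpa [h, h.ne] using hlt m h
  · subst h
    simpa using hi
  · simpa [h.not_gt, h.ne'] using hgt m h

/-- Positive weights, each dominating a multiple of the sum of the previous ones. -/
theorem exists_weights (n : ℕ) {Q : ℝ} (hQ : 0 ≤ Q) :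
    -- The powers of `1 + Q` give equality, by the geometric sum.
    ∃ K : Fin n → ℝ, (∀ i, 0 < K i) ∧ ∀ i, 1 + Q * ∑ m ∈ Finset.Iio i, K m ≤ K i := by
  refine ⟨fun i => (1 + Q) ^ (i : ℕ), fun i => by positivity, fun i => ?_⟩
  have h1 : ∑ m ∈ Finset.Iio i, (1 + Q) ^ (m : ℕ) = ∑ m ∈ Finset.range i, (1 + Q) ^ m := by
    refine Finset.sum_nbij (fun m => (m : ℕ)) ?_ ?_ ?_ ?_
    · intro m hm
      simpa using hm
    · intro a _ b _ h
      exact Fin.ext h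
    · intro m hm
      have hm : m < i := by simpa using hm
      exact ⟨⟨m, hm.trans i.2⟩, by simpa [Fin.lt_def] using hm, rfl⟩
    · simp
  have h2 := mul_geom_sum (1 + Q) (i : ℕ)
  rw [add_sub_cancel_left] at h2
  rw [h1, h2]
  linarith

/-- The coefficient of the `m`-th layer function in the `i`-th component of the barrier. -/
def barrierCoeff {n : ℕ} (K s : Fin n → ℝ) (κ : ℝ) (i m : Fin n) : ℝ :=
  if i ≤ m then K m / s m else -(κ * K m * s m / s i ^ 2)

theorem barrierCoeff_le {n : ℕ} {K s : Fin n → ℝ} {κ : ℝ} (hK : ∀ i, 0 < K i)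
    (hs : ∀ i, 0 < s i) (hκ : 0 ≤ κ) (i m : Fin n) : barrierCoeff K s κ i m ≤ K m / s m := by
  have := hK m
  have := hs m
  have := hs i
  unfold barrierCoeff
  split_ifs
  · exact le_rfl
  · have h1 : 0 ≤ κ * K m * s m / s i ^ 2 := by positivity
    have h2 : 0 ≤ K m / s m := by positivity
    linarith

theorem div_sq_le_inv {s t : ℝ} (ht : 0 < t) (hst : s ≤ t) : s / t ^ 2 ≤ 1 / t := by
  rw [div_le_div_iff₀ (by positivity) ht]
  nlinarith

/-- The negative coefficients cost at most `κ * K m * b i / s i` each, since `s` and `b` are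
monotone; the weight `K i` exceeds their total by 1. This makes the barrier dominate the increments
at the endpoints. -/
theorem barrier_lower {n : ℕ} {K s b : Fin n → ℝ} {κ : ℝ} (hK : ∀ i, 0 < K i)
    (hs : ∀ i, 0 < s i) (hκ : 0 ≤ κ) (hsm : Monotone s) (hb : ∀ i, 0 ≤ b i) (hbm : Monotone b)
    (hK₁ : ∀ i, 1 + κ * ∑ m ∈ Finset.Iio i, K m ≤ K i) (i : Fin n) :
    b i / s i ≤ ∑ m, barrierCoeff K s κ i m * b m := by
  have hsi := hs i
  have h1 := add_sum_Iio_le_sum (i := i) (p := K i / s i * b i)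
    (r := fun m => -(κ * b i / s i) * K m) (g := fun m => barrierCoeff K s κ i m * b m)
    (by simp [barrierCoeff]) (fun m hm => ?_) (fun m hm => ?_)
  · rw [← Finset.mul_sum] at h1
    refine le_trans ?_ h1
    have h2 := mul_le_mul_of_nonneg_right (hK₁ i) (div_nonneg (hb i) hsi.le)
    calc b i / s i ≤ (K i - κ * ∑ m ∈ Finset.Iio i, K m) * (b i / s i) := by linarith
      _ = _ := by ring
  · have h3 := div_sq_le_inv hsi (hsm hm.le)
    have h4 : κ * K m * (s m / s i ^ 2) * b m ≤ κ * K m * (1 / s i) * b i := by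
      have := (hK m).le
      have := hb m
      have := hbm hm.le
      have := hs m
      gcongr
    simp only [barrierCoeff, not_le.2 hm, if_false]
    calc -(κ * b i / s i) * K m = -(κ * K m * (1 / s i) * b i) := by ring
      _ ≤ -(κ * K m * (s m / s i ^ 2) * b m) := neg_le_neg h4
      _ = _ := by ring
  · have := (hK m).le
    have := (hs m).le
    have := hb m
    simp only [barrierCoeff, hm.le, if_true]
    positivity

theorem barrier_upper {n : ℕ} {K s b : Fin n → ℝ} {κ : ℝ} (hK : ∀ i, 0 < K i)
    (hs : ∀ i, 0 < s i) (hκ : 0 ≤ κ) (hb : ∀ i, 0 ≤ b i) (i : Fin n) :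
    ∑ m, barrierCoeff K s κ i m * b m ≤ ∑ m, K m / s m * b m :=
  Finset.sum_le_sum fun m _ => mul_le_mul_of_nonneg_right (barrierCoeff_le hK hs hκ i m) (hb m)

/-- The layer barrier is a supersolution. -/
theorem barrier_supersolution {n : ℕ} {K s b M : Fin n → ℝ} {α η a : ℝ} (hα : 0 < α)
    (hη : 0 < η) (ha : 0 ≤ a) (hK : ∀ i, 0 < K i) (hs : ∀ i, 0 < s i) (hsm : Monotone s)
    (hb : ∀ i, 0 ≤ b i) (hbm : Monotone b)
    {i : Fin n} (hK₂ : a * (a / α) * ∑ m ∈ Finset.Iio i, K m ≤ η * K i)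
    (hoff : ∀ j, i ≠ j → M j ≤ 0) (hrow : α + η ≤ ∑ j, M j) (hdiag : M i ≤ a) :
    0 ≤ -(α * s i ^ 2) * ∑ m, barrierCoeff K s (a / α) i m * (b m / s m ^ 2) +
      ∑ j, M j * ∑ m, barrierCoeff K s (a / α) j m * b m := by
  set c := barrierCoeff K s (a / α) with hc
  have hκ : 0 ≤ a / α := by positivity
  have hsi := hs i
  have hcle : ∀ j m, c j m ≤ K m / s m := barrierCoeff_le hK hs hκ
  have hKs : ∀ m, 0 < K m / s m := fun m => div_pos (hK m) (hs m)
  -- Off-diagonal entries are nonpositive, so raising each `c j m` with `j ≠ i` to `K m / s m` only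
  -- lowers the sum; the diagonal entry is corrected exactly.
  have hsum : ∀ m, (∑ j, M j) * (K m / s m) ≤
      ∑ j, M j * c j m + M i * (K m / s m - c i m) := by
    intro m
    have h1 := sum_mul_le_of_forall_ge (w := Function.update (fun j => -c j m) i (-(K m / s m)))
      hoff (fun j => by
        rw [Function.update_self]
        rcases eq_or_ne j i with rfl | h
        · rw [Function.update_self]
        · rw [Function.update_of_ne h]
          exact neg_le_neg (hcle j m))
    have h2 : ∑ j, M j * Function.update (fun j => -c j m) i (-(K m / s m)) j =
        -(∑ j, M j * c j m + M i * (K m / s m - c i m)) := by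
      have h3 : ∀ j, M j * Function.update (fun j => -c j m) i (-(K m / s m)) j =
          -(M j * c j m) + if j = i then -(M i * (K m / s m - c i m)) else 0 := by
        intro j
        rcases eq_or_ne j i with rfl | h
        · rw [Function.update_self, if_pos rfl]
          ring
        · rw [Function.update_of_ne h, if_neg h]
          ring
      simp only [h3, Finset.sum_add_distrib, Finset.sum_neg_distrib]
      rw [Finset.sum_ite_eq' Finset.univ i]
      simp only [Finset.mem_univ, if_true]
      ring
    rw [h2, Function.update_self] at h1
    linarith
  have hrowK : ∀ m, (α + η) * (K m / s m) ≤ (∑ j, M j) * (K m / s m) := fun m =>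
    mul_le_mul_of_nonneg_right hrow (hKs m).le
  have hge : ∀ m, i ≤ m →
      η * (K m / s m) ≤ -(α * s i ^ 2) * (c i m / s m ^ 2) + ∑ j, M j * c j m := by
    intro m hm
    have hcm : c i m = K m / s m := by simp [hc, barrierCoeff, hm]
    have h1 := hsum m
    rw [hcm, sub_self, mul_zero, add_zero] at h1
    have h2 : α * (s i ^ 2 / s m ^ 2) * (K m / s m) ≤ α * 1 * (K m / s m) := by
      have := (hKs m).le
      have : s i ^ 2 / s m ^ 2 ≤ 1 := div_le_one_of_le₀
        (pow_le_pow_left₀ hsi.le (hsm hm) 2) (by positivity)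
      gcongr
    rw [hcm]
    calc η * (K m / s m) = -(α * 1 * (K m / s m)) + (α + η) * (K m / s m) := by ring
      _ ≤ -(α * (s i ^ 2 / s m ^ 2) * (K m / s m)) + ∑ j, M j * c j m :=
        add_le_add (neg_le_neg h2) ((hrowK m).trans h1)
      _ = _ := by ring
  have hlt : ∀ m, m < i → -(a * (a / α) * K m / s i) ≤
      -(α * s i ^ 2) * (c i m / s m ^ 2) + ∑ j, M j * c j m := by
    intro m hm
    have hsm' := hs m
    have hcm : c i m = -(a / α * K m * s m / s i ^ 2) := by simp [hc, barrierCoeff, hm]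
    have hcn : c i m ≤ 0 := by
      rw [hcm]
      have := hK m
      exact neg_nonpos.2 (by positivity)
    -- The factor `a / α` in the negative coefficient is chosen for this: the diffusion term yields
    -- `a * K m / s m`, which pays for the diagonal correction up to the small term `a * c i m`.
    have h1 : -(α * s i ^ 2) * (c i m / s m ^ 2) = a * (K m / s m) := by
      rw [hcm]
      field_simp
    have h2 : M i * (K m / s m - c i m) ≤ a * (K m / s m - c i m) :=
      mul_le_mul_of_nonneg_right hdiag (by linarith [hKs m])
    have h3 : a * (a / α) * K m * (s m / s i ^ 2) ≤ a * (a / α) * K m * (1 / s i) :=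
      mul_le_mul_of_nonneg_left (div_sq_le_inv hsi (hsm hm.le))
        (by have := hK m; positivity)
    have h4 : a * c i m = -(a * (a / α) * K m * (s m / s i ^ 2)) := by
      rw [hcm]
      ring
    have h5 : 0 ≤ (α + η) * (K m / s m) := by have := hKs m; positivity
    have h6 : a * (a / α) * K m * (1 / s i) = a * (a / α) * K m / s i := by ring
    rw [h1]
    linarith [hsum m, hrowK m]
  have hmain := add_sum_Iio_le_sum (i := i) (p := η * (K i / s i) * b i)
    (r := fun m => -(a * (a / α) * b i / s i) * K m)
    (g := fun m => (-(α * s i ^ 2) * (c i m / s m ^ 2) + ∑ j, M j * c j m) * b m)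
    (mul_le_mul_of_nonneg_right (hge i le_rfl) (hb i)) (fun m hm => ?_) (fun m hm => ?_)
  · rw [← Finset.mul_sum] at hmain
    have h1 : ∑ m, (-(α * s i ^ 2) * (c i m / s m ^ 2) + ∑ j, M j * c j m) * b m =
        -(α * s i ^ 2) * ∑ m, c i m * (b m / s m ^ 2) + ∑ j, M j * ∑ m, c j m * b m := by
      simp only [add_mul, Finset.sum_add_distrib, Finset.mul_sum, Finset.sum_mul]
      rw [Finset.sum_comm (s := Finset.univ) (t := Finset.univ)
        (f := fun m j => M j * c j m * b m)]
      congr 1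
      · exact Finset.sum_congr rfl fun m _ => by ring
      · exact Finset.sum_congr rfl fun m _ => Finset.sum_congr rfl fun j _ => by ring
    rw [← h1]
    refine le_trans ?_ hmain
    have h2 := mul_le_mul_of_nonneg_right hK₂ (div_nonneg (hb i) hsi.le)
    calc 0 ≤ (η * K i - a * (a / α) * ∑ m ∈ Finset.Iio i, K m) * (b i / s i) := by linarith
      _ = _ := by ring
  · have h1 : a * (a / α) * K m / s i * b m ≤ a * (a / α) * K m / s i * b i :=
      mul_le_mul_of_nonneg_left (hbm hm.le) (by have := hK m; positivity)
    calc -(a * (a / α) * b i / s i) * K m = -(a * (a / α) * K m / s i * b i) := by ring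
      _ ≤ -(a * (a / α) * K m / s i) * b m := by linarith
      _ ≤ _ := mul_le_mul_of_nonneg_right (hlt m hm) (hb m)
  · have := hge m hm.le
    have h2 : 0 ≤ η * (K m / s m) := by have := hKs m; positivity
    exact mul_nonneg (h2.trans this) (hb m)

section APriori

/-! ### A priori bounds for the solution -/

/-- Quantitative bounds for the coefficients of the system. -/
structure CoefficientBounds {n : ℕ} (A : ℝ → Matrix (Fin n) (Fin n) ℝ) (f : ℝ → Fin n → ℝ)
    (α η a L F : ℝ) : Prop where
  off : ∀ x ∈ Icc (0 : ℝ) 1, ∀ i j, i ≠ j → A x i j ≤ 0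
  row : ∀ x ∈ Icc (0 : ℝ) 1, ∀ i, α + η ≤ ∑ j, A x i j
  diag : ∀ x ∈ Icc (0 : ℝ) 1, ∀ i, A x i i ≤ a
  lipA : ∀ x ∈ Icc (0 : ℝ) 1, ∀ y ∈ Icc (0 : ℝ) 1, ∀ i j, |A x i j - A y i j| ≤ L * |x - y|
  lipf : ∀ x ∈ Icc (0 : ℝ) 1, ∀ y ∈ Icc (0 : ℝ) 1, ∀ i, |f x i - f y i| ≤ L * |x - y|
  bddf : ∀ x ∈ Icc (0 : ℝ) 1, ∀ i, |f x i| ≤ F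
  α_pos : 0 < α
  η_pos : 0 < η
  a_nonneg : 0 ≤ a
  L_nonneg : 0 ≤ L
  F_nonneg : 0 ≤ F

/-- The functions `u i`, with first and second derivatives `u₁ i` and `u₂ i` in `(0,1)`, form a
solution of the system with diffusion coefficients `α * s i ^ 2`. -/
structure IsClassical {n : ℕ} (A : ℝ → Matrix (Fin n) (Fin n) ℝ) (f : ℝ → Fin n → ℝ) (α : ℝ)
    (s : Fin n → ℝ) (u u₁ u₂ : Fin n → ℝ → ℝ) : Prop where
  cont : ∀ i, ContinuousOn (u i) (Icc 0 1)
  deriv₁ : ∀ i, ∀ x ∈ Ioo (0 : ℝ) 1, HasDerivAt (u i) (u₁ i x) x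
  deriv₂ : ∀ i, ∀ x ∈ Ioo (0 : ℝ) 1, HasDerivAt (u₁ i) (u₂ i x) x
  eqn : ∀ x ∈ Ioo (0 : ℝ) 1, ∀ i, -(α * s i ^ 2) * u₂ i x + ∑ j, A x i j * u j x = f x i
  s_pos : ∀ i, 0 < s i
  s_mono : Monotone s
  s_le : ∀ i, α * s i ^ 2 ≤ 1

variable {n : ℕ} {A : ℝ → Matrix (Fin n) (Fin n) ℝ} {f : ℝ → Fin n → ℝ} {α η a L F : ℝ}
  {s : Fin n → ℝ} {u u₁ u₂ : Fin n → ℝ → ℝ}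

/-- By the signs of the entries, the absolute row sum is at most `2a` minus the row sum, and the row
sum is positive. -/
theorem CoefficientBounds.abs_sum_mul_le (hB : CoefficientBounds A f α η a L F) {x : ℝ}
    (hx : x ∈ Icc (0 : ℝ) 1) (i : Fin n) {w : Fin n → ℝ} {c : ℝ} (hw : ∀ j, |w j| ≤ c) :
    |∑ j, A x i j * w j| ≤ 2 * a * c := by
  have hc : 0 ≤ c := (abs_nonneg _).trans (hw i)
  have h1 : ∑ j, |A x i j| ≤ 2 * a := by
    have h2 : ∀ j, |A x i j| ≤ -A x i j + if j = i then 2 * a else 0 := by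
      intro j
      rcases eq_or_ne j i with rfl | h
      · have h3 := hB.diag x hx j
        have := hB.a_nonneg
        simp only [if_true]
        exact abs_le.2 ⟨by linarith, by linarith⟩
      · rw [abs_of_nonpos (hB.off x hx i j h.symm), if_neg h, add_zero]
    refine (Finset.sum_le_sum fun j _ => h2 j).trans ?_
    rw [Finset.sum_add_distrib, Finset.sum_ite_eq' Finset.univ i, Finset.sum_neg_distrib]
    simp only [Finset.mem_univ, if_true]
    linarith [hB.row x hx i, hB.α_pos, hB.η_pos]
  calc |∑ j, A x i j * w j| ≤ ∑ j, |A x i j| * c := by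
        refine (Finset.abs_sum_le_sum_abs _ _).trans (Finset.sum_le_sum fun j _ => ?_)
        rw [abs_mul]
        exact mul_le_mul_of_nonneg_left (hw j) (abs_nonneg _)
    _ ≤ _ := by
        rw [← Finset.sum_mul]
        exact mul_le_mul_of_nonneg_right h1 hc

theorem CoefficientBounds.abs_sum_sub_mul_le (hB : CoefficientBounds A f α η a L F) {x y : ℝ}
    (hx : x ∈ Icc (0 : ℝ) 1) (hy : y ∈ Icc (0 : ℝ) 1) (i : Fin n) {w : Fin n → ℝ} {c : ℝ}
    (hw : ∀ j, |w j| ≤ c) :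
    |∑ j, (A x i j - A y i j) * w j| ≤ n * c * L * |x - y| := by
  calc |∑ j, (A x i j - A y i j) * w j| ≤ ∑ _j : Fin n, L * |x - y| * c := by
        refine (Finset.abs_sum_le_sum_abs _ _).trans (Finset.sum_le_sum fun j _ => ?_)
        rw [abs_mul]
        exact mul_le_mul (hB.lipA x hx y hy i j) (hw j) (abs_nonneg _)
          (mul_nonneg hB.L_nonneg (abs_nonneg _))
    _ = _ := by
        rw [Finset.sum_const, Finset.card_univ, Fintype.card_fin, nsmul_eq_mul]
        ring

theorem IsClassical.diffusion_pos (hu : IsClassical A f α s u u₁ u₂) (hα : 0 < α) (i : Fin n) :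
    0 < α * s i ^ 2 := by
  have := hu.s_pos i
  positivity

/-- The constant `G + F / α` is a barrier, since the row sums are at least `α`. -/
theorem IsClassical.abs_le (hu : IsClassical A f α s u u₁ u₂)
    (hB : CoefficientBounds A f α η a L F) {G : ℝ} (h0 : ∀ i, |u i 0| ≤ G)
    (h1 : ∀ i, |u i 1| ≤ G) (i : Fin n) {x : ℝ} (hx : x ∈ Icc (0 : ℝ) 1) :
    |u i x| ≤ G + F / α := by
  have hα := hB.α_pos
  have hη := hB.η_pos
  have hF := hB.F_nonneg
  have hG : 0 ≤ G := (abs_nonneg _).trans (h0 i)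
  have hFα : 0 ≤ F / α := by positivity
  refine abs_le_of_barrier (hu.diffusion_pos hα) zero_le_one
    (fun x hx => hB.off x (Ioo_subset_Icc_self hx))
    (fun x hx i => (add_pos hα hη).trans_le (hB.row x (Ioo_subset_Icc_self hx) i))
    hu.cont hu.deriv₁ hu.deriv₂ (w := fun _ _ => G + F / α) (w₁ := fun _ _ => 0)
    (w₂ := fun _ _ => 0) (fun _ => continuousOn_const) (fun _ _ _ => hasDerivAt_const _ _)
    (fun _ _ _ => hasDerivAt_const _ _) (fun i => (h0 i).trans (by linarith))
    (fun i => (h1 i).trans (by linarith)) (fun x hx i => ?_) i x hx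
  have hx := Ioo_subset_Icc_self hx
  rw [hu.eqn x ‹_› i, mul_zero, zero_add, ← Finset.sum_mul]
  refine (hB.bddf x hx i).trans ?_
  calc F = α * (F / α) := by field_simp
    _ ≤ (∑ j, A x i j) * (G + F / α) := by
      have := hB.row x hx i
      exact mul_le_mul (by linarith) (by linarith) hFα (by linarith)

/-- The crude bound of the first derivative. -/
theorem IsClassical.abs_deriv_le (hu : IsClassical A f α s u u₁ u₂)
    (hB : CoefficientBounds A f α η a L F) {c : ℝ}
    (hc : ∀ i, ∀ x ∈ Icc (0 : ℝ) 1, |u i x| ≤ c) (i : Fin n) {x : ℝ} (hx : x ∈ Ioo (0 : ℝ) 1) :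
    |u₁ i x| ≤ (4 * c + F + 2 * a * c) / √α / s i := by
  have hα := hB.α_pos
  have hs := hu.s_pos i
  have hr : 0 < √α := Real.sqrt_pos.2 hα
  have hsq : √α * √α = α := Real.mul_self_sqrt hα.le
  have hle : √α * s i ≤ 1 := by
    by_contra! h
    have : 1 < (√α * s i) * (√α * s i) := by nlinarith
    have h2 := hu.s_le i
    rw [← hsq] at h2
    nlinarith
  have h2 : ∀ y ∈ Ioo (0 : ℝ) 1, |u₂ i y| ≤ (F + 2 * a * c) / (α * s i ^ 2) := by
    intro y hy
    have hy' := Ioo_subset_Icc_self hy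
    have hd := hu.diffusion_pos hα i
    rw [le_div_iff₀ hd]
    have h3 : |u₂ i y| * (α * s i ^ 2) = |∑ j, A y i j * u j y - f y i| := by
      rw [← abs_of_pos hd, ← abs_mul]
      congr 1
      linarith [hu.eqn y hy i]
    rw [h3]
    have h4 := hB.abs_sum_mul_le hy' i (w := fun j => u j y) fun j => hc j y hy'
    linarith [abs_sub (∑ j, A y i j * u j y) (f y i), hB.bddf y hy' i]
  -- A step length proportional to `s i` balances the two interpolation terms; `hle` keeps it at
  -- most `1/2`.
  have h3 := abs_deriv_le_of_abs_second_deriv_le (hu.cont i) (hu.deriv₁ i) (hu.deriv₂ i) (hc i) h2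
    (l := √α * s i / 2) (by positivity) (by linarith) hx
  have hc0 : 0 ≤ c := (abs_nonneg _).trans (hc i 0 ⟨le_rfl, zero_le_one⟩)
  have hX : 0 ≤ (F + 2 * a * c) / √α / s i := by
    have := hB.F_nonneg
    have := hB.a_nonneg
    positivity
  calc |u₁ i x| ≤ _ := h3
    _ = 4 * c / √α / s i + (F + 2 * a * c) / √α / s i / 2 := by
      rw [show α * s i ^ 2 = (√α * s i) * (√α * s i) by
        linear_combination (-(s i) ^ 2) * hsq]
      field_simp
      ring
    _ ≤ 4 * c / √α / s i + (F + 2 * a * c) / √α / s i := by linarith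
    _ = _ := by ring

/-- The two-sided layer function on `[0,l]` with scale `s`. -/
def layer (s l x : ℝ) : ℝ := Real.exp (-x / s) + Real.exp (-(l - x) / s)

theorem layer_nonneg (s l x : ℝ) : 0 ≤ layer s l x := by
  unfold layer
  positivity

theorem layer_mono {s t l x : ℝ} (hs : 0 < s) (hst : s ≤ t) (hx : 0 ≤ x) (hxl : x ≤ l) :
    layer s l x ≤ layer t l x := by
  have key : ∀ y : ℝ, 0 ≤ y → Real.exp (-y / s) ≤ Real.exp (-y / t) := by
    intro y hy
    rw [Real.exp_le_exp, neg_div, neg_div, neg_le_neg_iff]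
    gcongr
  exact add_le_add (key x hx) (key (l - x) (by linarith))

theorem hasDerivAt_layer (s l x : ℝ) :
    HasDerivAt (layer s l) ((Real.exp (-(l - x) / s) - Real.exp (-x / s)) / s) x := by
  have h1 := ((hasDerivAt_id x).neg.div_const s).exp
  have h2 := (((hasDerivAt_id x).const_sub l).neg.div_const s).exp
  refine (h1.add h2).congr_deriv ?_
  simp only [id, Pi.neg_apply]
  ring

theorem hasDerivAt_layer_deriv (s l x : ℝ) :
    HasDerivAt (fun x => (Real.exp (-(l - x) / s) - Real.exp (-x / s)) / s)
      (layer s l x / s ^ 2) x := by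
  have h1 := ((hasDerivAt_id x).neg.div_const s).exp
  have h2 := (((hasDerivAt_id x).const_sub l).neg.div_const s).exp
  refine ((h2.sub h1).div_const s).congr_deriv ?_
  simp only [id, Pi.neg_apply, layer]
  ring

theorem continuous_layer (s l : ℝ) : Continuous (layer s l) := by
  unfold layer
  fun_prop

/-- The bound for the increments of the solution. -/
theorem IsClassical.abs_increment_le (hu : IsClassical A f α s u u₁ u₂)
    (hB : CoefficientBounds A f α η a L F) {c d : ℝ}
    (hc : ∀ i, ∀ x ∈ Icc (0 : ℝ) 1, |u i x| ≤ c) (hc0 : 0 ≤ c) (hd0 : 0 ≤ d)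
    (hd : ∀ i, ∀ x ∈ Ioo (0 : ℝ) 1, |u₁ i x| ≤ d / s i) {K : Fin n → ℝ} (hK : ∀ i, 0 < K i)
    (hK₁ : ∀ i, 1 + a / α * ∑ m ∈ Finset.Iio i, K m ≤ K i)
    (hK₂ : ∀ i, a * (a / α) * ∑ m ∈ Finset.Iio i, K m ≤ η * K i) {h : ℝ} (h0 : 0 < h)
    (h1 : h < 1) (i : Fin n) {x : ℝ} (hx : x ∈ Icc (0 : ℝ) (1 - h)) :
    |u i (x + h) - u i x| ≤
      h * (L * (1 + n * c) / α + d * ∑ m, K m / s m * layer (s m) (1 - h) x) := by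
  have hα := hB.α_pos
  have hη := hB.η_pos
  have ha := hB.a_nonneg
  have hL0 := hB.L_nonneg
  have hκ : 0 ≤ a / α := by positivity
  have hs := hu.s_pos
  set e := L * (1 + n * c) / α with he
  have he0 : 0 ≤ e := by positivity
  have hl : (0 : ℝ) ≤ 1 - h := by linarith
  -- The constant `e` absorbs the Lipschitz variation of `A` and `f`; the layers dominate the
  -- boundary increments, as some exponential equals 1 at each endpoint.
  let w : Fin n → ℝ → ℝ := fun i x =>
    h * (e + d * ∑ m, barrierCoeff K s (a / α) i m * layer (s m) (1 - h) x)
  have hmem : ∀ x ∈ Icc (0 : ℝ) (1 - h), x ∈ Icc (0 : ℝ) 1 ∧ x + h ∈ Icc (0 : ℝ) 1 :=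
    fun x hx => ⟨⟨hx.1, by linarith [hx.2]⟩, ⟨by linarith [hx.1], by linarith [hx.2]⟩⟩
  have hmem' : ∀ x ∈ Ioo (0 : ℝ) (1 - h), x ∈ Ioo (0 : ℝ) 1 ∧ x + h ∈ Ioo (0 : ℝ) 1 :=
    fun x hx => ⟨⟨hx.1, by linarith [hx.2]⟩, ⟨by linarith [hx.1], by linarith [hx.2]⟩⟩
  have hbm : ∀ x ∈ Icc (0 : ℝ) (1 - h), Monotone fun m => layer (s m) (1 - h) x :=
    fun x hx m m' hm => layer_mono (hs m) (hu.s_mono hm) hx.1 hx.2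
  have hslope : ∀ i, ∀ y, 0 ≤ y → y + h ≤ 1 → |u i (y + h) - u i y| ≤ h * (d / s i) := by
    intro i y hy hy'
    obtain ⟨ξ, hξ, e⟩ := exists_hasDerivAt_eq_slope (u i) (u₁ i) (show y < y + h by linarith)
      ((hu.cont i).mono (Icc_subset_Icc hy hy'))
      fun z hz => hu.deriv₁ i z ⟨hy.trans_lt hz.1, hz.2.trans_le hy'⟩
    have h3 := hd i ξ ⟨hy.trans_lt hξ.1, hξ.2.trans_le hy'⟩
    rw [e, add_sub_cancel_left, abs_div, abs_of_pos h0, div_le_iff₀ h0] at h3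
    linarith
  have hbd : ∀ i, ∀ y ∈ Icc (0 : ℝ) (1 - h), (∀ m, 1 ≤ layer (s m) (1 - h) y) →
      h * (d / s i) ≤ w i y := by
    intro i y hy hy1
    have h3 := barrier_lower hK hs hκ hu.s_mono (fun m => layer_nonneg (s m) (1 - h) y)
      (hbm y hy) hK₁ i
    have h4 : 1 / s i ≤ layer (s i) (1 - h) y / s i :=
      div_le_div_of_nonneg_right (hy1 i) (hs i).le
    have h5 := mul_le_mul_of_nonneg_left (h4.trans h3) hd0
    refine mul_le_mul_of_nonneg_left ?_ h0.le
    rw [mul_one_div] at h5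
    linarith
  have main := abs_le_of_barrier (hu.diffusion_pos hα) hl
    (M := A) (fun x hx => hB.off x (Ioo_subset_Icc_self (hmem' x hx).1))
    (fun x hx i => (add_pos hα hη).trans_le
      (hB.row x (Ioo_subset_Icc_self (hmem' x hx).1) i))
    (v := fun i x => u i (x + h) - u i x) (v₁ := fun i x => u₁ i (x + h) - u₁ i x)
    (v₂ := fun i x => u₂ i (x + h) - u₂ i x) (w := w)
    (w₁ := fun i x => h * (d * ∑ m, barrierCoeff K s (a / α) i m *
      ((Real.exp (-(1 - h - x) / s m) - Real.exp (-x / s m)) / s m)))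
    (w₂ := fun i x => h * (d * ∑ m, barrierCoeff K s (a / α) i m *
      (layer (s m) (1 - h) x / s m ^ 2)))
    (fun i => ((hu.cont i).comp (by fun_prop) fun x hx => (hmem x hx).2).sub
      ((hu.cont i).mono fun x hx => (hmem x hx).1))
    (fun i x hx => (HasDerivAt.comp_add_const x h (hu.deriv₁ i _ (hmem' x hx).2)).sub
      (hu.deriv₁ i _ (hmem' x hx).1))
    (fun i x hx => (HasDerivAt.comp_add_const x h (hu.deriv₂ i _ (hmem' x hx).2)).sub
      (hu.deriv₂ i _ (hmem' x hx).1))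
    (fun i => by
      have := fun m => continuous_layer (s m) (1 - h)
      simp only [w]
      fun_prop)
    (fun i x _ => ((((HasDerivAt.fun_sum fun m _ => (hasDerivAt_layer (s m) (1 - h) x).const_mul
      (barrierCoeff K s (a / α) i m)).const_mul d).const_add e).const_mul h))
    (fun i x _ => ((HasDerivAt.fun_sum fun m _ =>
      (hasDerivAt_layer_deriv (s m) (1 - h) x).const_mul
        (barrierCoeff K s (a / α) i m)).const_mul d).const_mul h)
    (fun i => (hslope i 0 le_rfl (by linarith)).trans
      (hbd i 0 ⟨le_rfl, hl⟩ fun m => by simp [layer, Real.exp_nonneg]))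
    (fun i => (hslope i (1 - h) hl (by linarith)).trans
      (hbd i (1 - h) ⟨hl, le_rfl⟩ fun m => by simp [layer, Real.exp_nonneg]))
    (fun x hx i => ?_) i x hx
  · refine main.trans (mul_le_mul_of_nonneg_left ?_ h0.le)
    exact add_le_add le_rfl (mul_le_mul_of_nonneg_left
      (barrier_upper hK hs hκ (fun m => layer_nonneg (s m) (1 - h) x) i) hd0)
  · have hx0 := Ioo_subset_Icc_self (hmem' x hx).1
    have hxh := Ioo_subset_Icc_self (hmem' x hx).2
    have e1 := hu.eqn x (hmem' x hx).1 i
    have e2 := hu.eqn (x + h) (hmem' x hx).2 i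
    -- The increments solve the system with coefficients frozen at `x`; the change of `A` moves to
    -- the right-hand side.
    have e3 : -(α * s i ^ 2) * (u₂ i (x + h) - u₂ i x) +
        ∑ j, A x i j * (u j (x + h) - u j x) =
        (f (x + h) i - f x i) - ∑ j, (A (x + h) i j - A x i j) * u j (x + h) := by
      rw [← e1, ← e2]
      simp only [mul_sub, sub_mul, Finset.sum_sub_distrib]
      ring
    have hh : |x + h - x| = h := by rw [add_sub_cancel_left, abs_of_pos h0]
    have h3 := hB.lipf _ hxh _ hx0 i
    have h4 := hB.abs_sum_sub_mul_le hxh hx0 i (w := fun j => u j (x + h))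
      fun j => hc j _ hxh
    rw [hh] at h3 h4
    have h5 := barrier_supersolution hα hη ha hK hs hu.s_mono
      (fun m => layer_nonneg (s m) (1 - h) x) (hbm x (Ioo_subset_Icc_self hx)) (hK₂ i)
      (hB.off x hx0 i) (hB.row x hx0 i) (hB.diag x hx0 i)
    have h6 : ∀ j, A x i j * w j x = A x i j * (h * e) + h * d *
        (A x i j * ∑ m, barrierCoeff K s (a / α) j m * layer (s m) (1 - h) x) := by
      intro j
      simp only [w]
      ring
    rw [e3]
    simp only [h6, Finset.sum_add_distrib]
    rw [← Finset.mul_sum, ← Finset.sum_mul]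
    have h7 : α * (h * e) ≤ (∑ j, A x i j) * (h * e) :=
      mul_le_mul_of_nonneg_right (by linarith [hB.row x hx0 i]) (by positivity)
    have h8 : α * (h * e) = h * (L * (1 + n * c)) := by
      rw [he]
      field_simp
    have h9 := mul_nonneg (mul_nonneg h0.le hd0) h5
    have h10 := abs_sub (f (x + h) i - f x i) (∑ j, (A (x + h) i j - A x i j) * u j (x + h))
    linarith

/-- Divide the increment bound by `h` and let `h → 0⁺`. -/
theorem IsClassical.abs_deriv_le_layer (hu : IsClassical A f α s u u₁ u₂)
    (hB : CoefficientBounds A f α η a L F) {c d : ℝ}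
    (hc : ∀ i, ∀ x ∈ Icc (0 : ℝ) 1, |u i x| ≤ c) (hc0 : 0 ≤ c) (hd0 : 0 ≤ d)
    (hd : ∀ i, ∀ x ∈ Ioo (0 : ℝ) 1, |u₁ i x| ≤ d / s i) {K : Fin n → ℝ} (hK : ∀ i, 0 < K i)
    (hK₁ : ∀ i, 1 + a / α * ∑ m ∈ Finset.Iio i, K m ≤ K i)
    (hK₂ : ∀ i, a * (a / α) * ∑ m ∈ Finset.Iio i, K m ≤ η * K i) (i : Fin n) {x : ℝ}
    (hx : x ∈ Ioo (0 : ℝ) 1) :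
    |u₁ i x| ≤ L * (1 + n * c) / α + d * ∑ m, K m / s m * layer (s m) 1 x := by
  have h1 := (hu.deriv₁ i x hx).tendsto_slope_zero_right.abs
  have h2 : Tendsto (fun h : ℝ => L * (1 + n * c) / α +
      d * ∑ m, K m / s m * layer (s m) (1 - h) x) (𝓝[>] 0)
      (𝓝 (L * (1 + n * c) / α + d * ∑ m, K m / s m * layer (s m) (1 - 0) x)) := by
    refine (Continuous.tendsto ?_ 0).mono_left nhdsWithin_le_nhds
    unfold layer
    fun_prop
  rw [sub_zero] at h2
  refine le_of_tendsto_of_tendsto h1 h2 ?_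
  have h3 : Ioo (0 : ℝ) (1 - x) ∈ 𝓝[>] (0 : ℝ) := Ioo_mem_nhdsGT (by linarith [hx.2])
  filter_upwards [h3] with h hh
  have h4 := hu.abs_increment_le hB hc hc0 hd0 hd hK hK₁ hK₂ hh.1
    (by linarith [hh.2, hx.1]) i (x := x) ⟨hx.1.le, by linarith [hh.2]⟩
  rw [smul_eq_mul, abs_mul, abs_inv, abs_of_pos hh.1, inv_mul_le_iff₀ hh.1]
  exact h4

/-- The modulus of continuity of the solution, resolving all layers. -/
theorem IsClassical.abs_sub_le (hu : IsClassical A f α s u u₁ u₂) {D : ℝ} {K : Fin n → ℝ}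
    (hD : ∀ i, ∀ x ∈ Ioo (0 : ℝ) 1, |u₁ i x| ≤ D + ∑ m, K m / s m * layer (s m) 1 x) {x y : ℝ}
    (hx : 0 ≤ x) (hxy : x ≤ y) (hy : y ≤ 1) (i : Fin n) :
    |u i y - u i x| ≤ D * (y - x) + ∑ m, K m * ((Real.exp (-x / s m) - Real.exp (-y / s m)) +
      (Real.exp (-(1 - y) / s m) - Real.exp (-(1 - x) / s m))) := by
  -- An antiderivative of the bound for `|u₁ i|`, so that `g - u i` and `g + u i` are both monotone.
  let g : ℝ → ℝ := fun z =>
    D * z + ∑ m, K m * (Real.exp (-(1 - z) / s m) - Real.exp (-z / s m))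
  have hg : ∀ z, HasDerivAt g (D + ∑ m, K m / s m * layer (s m) 1 z) z := by
    intro z
    have h1 : ∀ m, HasDerivAt (fun z => K m * (Real.exp (-(1 - z) / s m) - Real.exp (-z / s m)))
        (K m / s m * layer (s m) 1 z) z := by
      intro m
      have h1 := ((hasDerivAt_id z).neg.div_const (s m)).exp
      have h2 := (((hasDerivAt_id z).const_sub 1).neg.div_const (s m)).exp
      refine ((h2.sub h1).const_mul (K m)).congr_deriv ?_
      simp only [id, Pi.neg_apply, layer]
      ring
    refine (((hasDerivAt_id z).const_mul D).add
      (HasDerivAt.fun_sum fun m _ => h1 m)).congr_deriv ?_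
    ring
  have hgc : Continuous g := continuous_iff_continuousAt.2 fun z => (hg z).continuousAt
  have hmem : x ∈ Icc (0 : ℝ) 1 := ⟨hx, hxy.trans hy⟩
  have hmem' : y ∈ Icc (0 : ℝ) 1 := ⟨hx.trans hxy, hy⟩
  have hsub : MonotoneOn (fun z => g z - u i z) (Icc 0 1) := by
    refine monotoneOn_of_deriv_nonneg (convex_Icc 0 1) (hgc.continuousOn.sub (hu.cont i)) ?_ ?_
    · rw [interior_Icc]
      exact fun z hz => ((hg z).sub (hu.deriv₁ i z hz)).differentiableAt.differentiableWithinAt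
    · rw [interior_Icc]
      intro z hz
      rw [((hg z).fun_sub (hu.deriv₁ i z hz)).deriv]
      linarith [(_root_.abs_le.1 (hD i z hz)).2]
  have hadd : MonotoneOn (fun z => g z + u i z) (Icc 0 1) := by
    refine monotoneOn_of_deriv_nonneg (convex_Icc 0 1) (hgc.continuousOn.add (hu.cont i)) ?_ ?_
    · rw [interior_Icc]
      exact fun z hz => ((hg z).add (hu.deriv₁ i z hz)).differentiableAt.differentiableWithinAt
    · rw [interior_Icc]
      intro z hz
      rw [((hg z).fun_add (hu.deriv₁ i z hz)).deriv]
      linarith [(_root_.abs_le.1 (hD i z hz)).1]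
  have h1 := hsub hmem hmem' hxy
  have h2 := hadd hmem hmem' hxy
  simp only at h1 h2
  have h3 : D * (y - x) + ∑ m, K m * ((Real.exp (-x / s m) - Real.exp (-y / s m)) +
      (Real.exp (-(1 - y) / s m) - Real.exp (-(1 - x) / s m))) = g y - g x := by
    simp only [g]
    rw [add_sub_add_comm, ← mul_sub, ← Finset.sum_sub_distrib]
    congr 1
    exact Finset.sum_congr rfl fun m _ => by ring
  rw [h3, _root_.abs_le]
  exact ⟨by linarith, by linarith⟩

end APriori

/-! ### The mesh -/

section Mesh

variable {n : ℕ} {ε : Fin n → ℝ} {α : ℝ} {N : ℕ}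

theorem transition_of_le {i : ℕ} (h : n ≤ i) : transition ε α N i = 1 / 2 := by
  rw [transition, dif_neg h.not_gt]

theorem transition_of_lt {i : ℕ} (h : i < n) : transition ε α N i =
    min (transition ε α N (i + 1) / 2) (√(ε ⟨i, h⟩ / α) * Real.log N) := by
  rw [transition, dif_pos h]

theorem transition_pos (hε : ∀ i, 0 < ε i) (hα : 0 < α) (hN : 1 < N) (i : ℕ) :
    0 < transition ε α N i := by
  induction h : n - i generalizing i with
  | zero =>
    rw [transition_of_le (by omega)]
    norm_num
  | succ k ih =>
    rw [transition_of_lt (by omega)]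
    have h1 := ih (i + 1) (by omega)
    have h2 : 0 < Real.log N := Real.log_pos (by exact_mod_cast hN)
    have h3 := hε ⟨i, by omega⟩
    exact lt_min (by positivity) (by positivity)

theorem transition_le_half_succ {i : ℕ} (h : i < n) :
    transition ε α N i ≤ transition ε α N (i + 1) / 2 := by
  rw [transition_of_lt h]
  exact min_le_left _ _

theorem transition_le_scale (m : Fin n) :
    transition ε α N m ≤ √(ε m / α) * Real.log N := by
  rw [transition_of_lt m.2]
  exact min_le_right _ _

theorem transition_mono (hε : ∀ i, 0 < ε i) (hα : 0 < α) (hN : 1 < N) :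
    Monotone (transition ε α N) := by
  refine monotone_nat_of_le_succ fun i => ?_
  rcases lt_or_ge i n with h | h
  · linarith [transition_le_half_succ (ε := ε) (α := α) (N := N) h,
      transition_pos hε hα hN (i + 1)]
  · rw [transition_of_le h, transition_of_le (by omega)]

theorem transition_le (hε : ∀ i, 0 < ε i) (hα : 0 < α) (hN : 1 < N) (i : ℕ) :
    transition ε α N i ≤ 1 / 2 := by
  rw [← transition_of_le (ε := ε) (α := α) (N := N) (le_max_left n i)]
  exact transition_mono hε hα hN (le_max_right n i)

theorem breakpoint_zero : breakpoint ε α N 0 = 0 := rfl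

theorem breakpoint_of_le {k : ℕ} (h0 : 0 < k) (h : k ≤ n) :
    breakpoint ε α N k = transition ε α N (k - 1) := by
  obtain ⟨k, rfl⟩ := Nat.exists_eq_add_of_lt h0
  simp only [zero_add] at h ⊢
  rw [breakpoint, if_pos (by omega), Nat.add_sub_cancel]

theorem breakpoint_of_gt {k : ℕ} (h : n < k) (h' : k ≤ 2 * n) :
    breakpoint ε α N k = 1 - transition ε α N (2 * n - k) := by
  obtain ⟨k, rfl⟩ := Nat.exists_eq_add_of_lt (Nat.zero_lt_of_lt h)
  simp only [zero_add] at h h' ⊢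
  rw [breakpoint, if_neg (by omega), if_pos (by omega)]
  congr 2
  omega

theorem breakpoint_last : breakpoint ε α N (2 * n + 1) = 1 := by
  rw [breakpoint, if_neg (by omega), if_neg (by omega)]

/-- The mesh is symmetric about `1/2`, so facts about left layers transfer to right layers. -/
theorem breakpoint_reflect {k : ℕ} (h : k ≤ 2 * n + 1) :
    breakpoint ε α N (2 * n + 1 - k) = 1 - breakpoint ε α N k := by
  rcases Nat.eq_zero_or_pos k with rfl | h0
  · rw [breakpoint_zero, Nat.sub_zero, breakpoint_last, sub_zero]
  rcases h.eq_or_lt with rfl | h1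
  · rw [Nat.sub_self, breakpoint_zero, breakpoint_last, sub_self]
  rcases le_or_gt k n with h2 | h2
  · rw [breakpoint_of_le h0 h2, breakpoint_of_gt (by omega) (by omega)]
    congr 2
    omega
  · rw [breakpoint_of_gt h2 (by omega), breakpoint_of_le (by omega) (by omega), sub_sub_cancel]
    congr 1
    omega

theorem breakpoint_lt_succ_of_le (hn : 1 ≤ n) (hε : ∀ i, 0 < ε i) (hα : 0 < α) (hN : 1 < N)
    {k : ℕ} (h : k ≤ n) : breakpoint ε α N k < breakpoint ε α N (k + 1) := by
  rcases Nat.eq_zero_or_pos k with rfl | h0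
  · rw [breakpoint_zero, breakpoint_of_le (by omega) hn]
    exact transition_pos hε hα hN _
  have h1 := transition_le_half_succ (ε := ε) (α := α) (N := N) (show k - 1 < n by omega)
  rw [show k - 1 + 1 = k by omega] at h1
  have h2 := transition_pos hε hα hN k
  rw [breakpoint_of_le h0 h]
  rcases h.eq_or_lt with rfl | h3
  · rw [breakpoint_of_gt (by omega) (by omega), show 2 * k - (k + 1) = k - 1 by omega]
    rw [transition_of_le le_rfl] at h1
    linarith
  · rw [breakpoint_of_le (by omega) (show k + 1 ≤ n from h3), Nat.add_sub_cancel]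
    linarith

theorem breakpoint_lt_succ (hn : 1 ≤ n) (hε : ∀ i, 0 < ε i) (hα : 0 < α) (hN : 1 < N)
    {k : ℕ} (h : k ≤ 2 * n) : breakpoint ε α N k < breakpoint ε α N (k + 1) := by
  rcases le_or_gt k n with h1 | h1
  · exact breakpoint_lt_succ_of_le hn hε hα hN h1
  · have h2 := breakpoint_lt_succ_of_le hn hε hα hN (show 2 * n - k ≤ n by omega)
    rw [show 2 * n - k = 2 * n + 1 - (k + 1) by omega, breakpoint_reflect (by omega),
      show 2 * n + 1 - (k + 1) + 1 = 2 * n + 1 - k by omega, breakpoint_reflect (by omega)] at h2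
    linarith

theorem breakpoint_le (hn : 1 ≤ n) (hε : ∀ i, 0 < ε i) (hα : 0 < α) (hN : 1 < N)
    {k l : ℕ} (h : k ≤ l) (hl : l ≤ 2 * n + 1) : breakpoint ε α N k ≤ breakpoint ε α N l := by
  induction l, h using Nat.le_induction with
  | base => exact le_rfl
  | succ l _ ih => exact (ih (by omega)).trans (breakpoint_lt_succ hn hε hα hN (by omega)).le

/-- Every subinterval lies outside the left layer of a given scale, or its length is bounded by
the width of this layer. -/
theorem scale_le_breakpoint_or_width_le (hn : 1 ≤ n) (hε : ∀ i, 0 < ε i) (hεm : Monotone ε)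
    (hα : 0 < α) (hN : 1 < N) {k : ℕ} (hk : k ≤ 2 * n) (m : Fin n) :
    √(ε m / α) * Real.log N ≤ breakpoint ε α N k ∨
      breakpoint ε α N (k + 1) - breakpoint ε α N k ≤ 2 * (√(ε m / α) * Real.log N) := by
  have hlog : 0 < Real.log N := Real.log_pos (by exact_mod_cast hN)
  have hr : 0 ≤ √(ε m / α) * Real.log N := by positivity
  have hTm := transition_le_scale (ε := ε) (α := α) (N := N) m
  have hmono := transition_mono hε hα hN
  rcases Nat.eq_zero_or_pos k with rfl | h0
  · right
    rw [breakpoint_zero, breakpoint_of_le (by omega) hn]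
    linarith [hmono (show 0 + 1 - 1 ≤ (m : ℕ) by omega)]
  rcases le_or_gt k n with h1 | h1
  · rw [breakpoint_of_le h0 h1]
    refine or_iff_not_imp_left.2 fun hlt => ?_
    have hlt := not_le.1 hlt
    rcases lt_or_ge (m : ℕ) k with hm | hm
    · have h2 : √(ε m / α) ≤ √(ε ⟨k - 1, by omega⟩ / α) := by
        refine Real.sqrt_le_sqrt ((div_le_div_iff_of_pos_right hα).2 (hεm ?_))
        rw [Fin.le_def]
        simp only
        omega
      have h3 := mul_le_mul_of_nonneg_right h2 hlog.le
      -- The left endpoint lies below the scale of `m`, hence below its own, so its minimum is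
      -- attained by the halving branch. The width is then the left endpoint itself, or twice it for
      -- the central piece.
      have h4 : transition ε α N (k - 1) = transition ε α N k / 2 := by
        have h5 := transition_of_lt (ε := ε) (α := α) (N := N) (show k - 1 < n by omega)
        rw [show k - 1 + 1 = k by omega] at h5
        rcases min_choice (transition ε α N k / 2) (√(ε ⟨k - 1, by omega⟩ / α) * Real.log N)
          with h | h
        · rw [h5, h]
        · rw [h] at h5
          linarith
      rcases h1.eq_or_lt with rfl | h6
      · rw [breakpoint_of_gt (by omega) (by omega), show 2 * k - (k + 1) = k - 1 by omega]
        rw [transition_of_le le_rfl] at h4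
        linarith
      · rw [breakpoint_of_le (by omega) (show k + 1 ≤ n from h6), Nat.add_sub_cancel]
        linarith
    · rw [breakpoint_of_le (by omega) (by omega), Nat.add_sub_cancel]
      linarith [hmono hm, transition_pos hε hα hN (k - 1)]
  · have h2 : (1 : ℝ) / 2 ≤ breakpoint ε α N k := by
      rw [breakpoint_of_gt h1 hk]
      linarith [transition_le hε hα hN (2 * n - k)]
    have h3 := breakpoint_le hn hε hα hN (show k + 1 ≤ 2 * n + 1 by omega) le_rfl
    rw [breakpoint_last] at h3
    rcases le_total (√(ε m / α) * Real.log N) (1 / 2) with h | h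
    · left
      linarith
    · right
      linarith

theorem scale_le_reflect_or_width_le (hn : 1 ≤ n) (hε : ∀ i, 0 < ε i) (hεm : Monotone ε)
    (hα : 0 < α) (hN : 1 < N) {k : ℕ} (hk : k ≤ 2 * n) (m : Fin n) :
    √(ε m / α) * Real.log N ≤ 1 - breakpoint ε α N (k + 1) ∨
      breakpoint ε α N (k + 1) - breakpoint ε α N k ≤ 2 * (√(ε m / α) * Real.log N) := by
  have h := scale_le_breakpoint_or_width_le hn hε hεm hα hN (show 2 * n - k ≤ 2 * n by omega) m
  rw [show 2 * n - k = 2 * n + 1 - (k + 1) by omega, breakpoint_reflect (by omega),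
    show 2 * n + 1 - (k + 1) + 1 = 2 * n + 1 - k by omega, breakpoint_reflect (by omega)] at h
  refine h.imp id fun h => ?_
  linarith

theorem exists_meshCount_eq (N : ℕ) {k : ℕ} (hk : k ≤ 2 * n) :
    ∃ p ≤ n + 1, meshCount n N k = N / 2 ^ p := by
  unfold meshCount
  split_ifs with h1 h2 h3
  · exact ⟨1, by omega, by rw [pow_one]⟩
  · exact ⟨n + 1, le_rfl, rfl⟩
  · exact ⟨n - k + 2, by omega, rfl⟩
  · exact ⟨k - n + 2, by omega, rfl⟩

theorem le_meshCount_mul (hN : 2 ^ (n + 1) ∣ N) {k : ℕ} (hk : k ≤ 2 * n) :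
    N ≤ meshCount n N k * 2 ^ (n + 1) := by
  obtain ⟨p, hp, h⟩ := exists_meshCount_eq N hk
  rw [h]
  calc N = N / 2 ^ p * 2 ^ p := (Nat.div_mul_cancel ((pow_dvd_pow 2 hp).trans hN)).symm
    _ ≤ _ := Nat.mul_le_mul_left _ (Nat.pow_le_pow_right (by norm_num) hp)

theorem meshCount_pos (hN : 1 < N) (hd : 2 ^ (n + 1) ∣ N) {k : ℕ} (hk : k ≤ 2 * n) :
    0 < meshCount n N k := by
  by_contra! h
  have := le_meshCount_mul hd hk
  rw [Nat.le_zero.1 h, zero_mul] at this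
  omega

theorem meshOffset_succ (n N k : ℕ) :
    meshOffset n N (k + 1) = meshOffset n N k + meshCount n N k := Finset.sum_range_succ _ _

theorem pow_mul_div_pow {p r : ℕ} (q : ℕ) (h : p ≤ r) :
    2 ^ r * q / 2 ^ p = 2 ^ (r - p) * q := by
  obtain ⟨d, rfl⟩ := Nat.exists_eq_add_of_le h
  rw [pow_add, mul_assoc, Nat.mul_div_cancel_left _ (by positivity), Nat.add_sub_cancel_left]

/-- The counts are `q, q, 2q, 4q, …`, so each partial sum doubles the previous one. -/
theorem meshOffset_left (q : ℕ) {k : ℕ} (hk : k + 1 ≤ n) :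
    meshOffset n (2 ^ (n + 1) * q) (k + 1) = 2 ^ k * q := by
  induction k with
  | zero =>
    rw [meshOffset_succ, meshOffset, Finset.sum_range_zero, meshCount, if_neg (by omega),
      if_pos (by omega), pow_mul_div_pow q le_rfl]
    simp
  | succ k ih =>
    rw [meshOffset_succ, ih (by omega), meshCount, if_neg (by omega), if_neg (by omega),
      if_pos (by omega), pow_mul_div_pow q (by omega),
      show n + 1 - (n - (k + 1) + 2) = k by omega]
    ring

/-- The number of intervals still to the right is the mirrored left offset; the additive form avoids
truncated subtraction. -/
theorem meshOffset_right (q : ℕ) {t : ℕ} (ht : t + 1 ≤ n) :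
    meshOffset n (2 ^ (n + 1) * q) (n + 1 + t) + 2 ^ (n - 1 - t) * q = 2 ^ (n + 1) * q := by
  induction t with
  | zero =>
    obtain ⟨r, rfl⟩ := Nat.exists_eq_add_of_le' ht
    rw [add_zero, meshOffset_succ, meshOffset_left q (by omega), meshCount, if_pos (by omega)]
    have h1 := pow_mul_div_pow (p := 1) (r := r + 0 + 1 + 1) q (by omega)
    rw [pow_one] at h1
    rw [h1, show r + 0 + 1 + 1 - 1 = r + 1 by omega, show r + 0 + 1 - 1 - 0 = r by omega]
    ring
  | succ t ih =>
    refine Eq.trans ?_ (ih (by omega))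
    rw [← add_assoc, meshOffset_succ, meshCount, if_neg (by omega),
      if_neg (by omega), if_neg (by omega), pow_mul_div_pow q (by omega),
      show n + 1 - (n + 1 + t - n + 2) = n - 1 - (t + 1) by omega,
      show n - 1 - t = n - 1 - (t + 1) + 1 by omega]
    ring

theorem meshOffset_last (hn : 1 ≤ n) (hd : 2 ^ (n + 1) ∣ N) : meshOffset n N (2 * n + 1) = N := by
  obtain ⟨q, rfl⟩ := hd
  have h := meshOffset_right q (show n - 1 + 1 ≤ n by omega)
  rw [show n + 1 + (n - 1) = 2 * n by omega, Nat.sub_self, pow_zero, one_mul] at h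
  rw [meshOffset_succ, meshCount, if_neg (by omega), if_pos (by omega), pow_mul_div_pow q le_rfl,
    Nat.sub_self, pow_zero, one_mul, h]

theorem exists_meshOffset_le (n N : ℕ) {j r : ℕ} (h : j < meshOffset n N r) :
    ∃ k < r, meshOffset n N k ≤ j ∧ j < meshOffset n N k + meshCount n N k := by
  induction r with
  | zero => simp [meshOffset] at h
  | succ r ih =>
    rcases lt_or_ge j (meshOffset n N r) with h1 | h1
    · obtain ⟨k, hk, h2⟩ := ih h1
      exact ⟨k, by omega, h2⟩
    · exact ⟨r, by omega, h1, by rwa [← meshOffset_succ]⟩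

theorem meshPoint_zero (hN : 1 < N) (hd : 2 ^ (n + 1) ∣ N) : meshPoint ε α N 0 = 0 := by
  have h := meshPoint_offset_add ε α N 0 0 (by omega) (fun r hr => meshCount_pos hN hd hr)
    (by omega)
  simpa [meshOffset, breakpoint_zero] using h

theorem meshPoint_last (hn : 1 ≤ n) (hN : 1 < N) (hd : 2 ^ (n + 1) ∣ N) :
    meshPoint ε α N N = 1 := by
  have h := meshPoint_offset_add ε α N (2 * n) (meshCount n N (2 * n)) le_rfl
    (fun r hr => meshCount_pos hN hd hr) le_rfl
  have h0 : (meshCount n N (2 * n) : ℝ) ≠ 0 := by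
    exact_mod_cast (meshCount_pos hN hd (le_refl (2 * n))).ne'
  rw [← meshOffset_succ, meshOffset_last hn hd, mul_div_cancel₀ _ h0, breakpoint_last] at h
  rw [h]
  ring

/-- A mesh interval lies in one of the subintervals, which it divides evenly. -/
theorem exists_subinterval (hn : 1 ≤ n) (hε : ∀ i, 0 < ε i) (hα : 0 < α) (hN : 1 < N)
    (hd : 2 ^ (n + 1) ∣ N) {j : ℕ} (hj : j < N) :
    ∃ k ≤ 2 * n, breakpoint ε α N k ≤ meshPoint ε α N j ∧
      meshPoint ε α N (j + 1) ≤ breakpoint ε α N (k + 1) ∧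
      meshPoint ε α N j < meshPoint ε α N (j + 1) ∧
      meshPoint ε α N (j + 1) - meshPoint ε α N j ≤
        2 ^ (n + 1) / N * (breakpoint ε α N (k + 1) - breakpoint ε α N k) := by
  obtain ⟨k, hk, h1, h2⟩ := exists_meshOffset_le n N (j := j) (r := 2 * n + 1)
    (by rwa [meshOffset_last hn hd])
  obtain ⟨l, rfl⟩ := Nat.exists_eq_add_of_le h1
  have hk : k ≤ 2 * n := by omega
  have hpos : ∀ r ≤ 2 * n, 0 < meshCount n N r := fun r hr => meshCount_pos hN hd hr
  have e1 := meshPoint_offset_add ε α N k l hk hpos (by omega)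
  have e2 := meshPoint_offset_add ε α N k (l + 1) hk hpos (by omega)
  have hw := sub_pos.2 (breakpoint_lt_succ hn hε hα hN hk)
  set w := breakpoint ε α N (k + 1) - breakpoint ε α N k with hwdef
  have hc : (0 : ℝ) < meshCount n N k := by exact_mod_cast hpos k hk
  have hwc : 0 < w / meshCount n N k := div_pos hw hc
  have hl : ((l + 1 : ℕ) : ℝ) ≤ meshCount n N k := by exact_mod_cast (by omega)
  have hl' := mul_le_mul_of_nonneg_right hl hwc.le
  rw [mul_div_cancel₀ _ hc.ne'] at hl'
  have hN0 : (0 : ℝ) < N := by exact_mod_cast (by omega)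
  have hle : (N : ℝ) ≤ meshCount n N k * 2 ^ (n + 1) := by exact_mod_cast le_meshCount_mul hd hk
  have hstep : w / meshCount n N k ≤ 2 ^ (n + 1) / N * w := by
    rw [div_mul_eq_mul_div, div_le_div_iff₀ hc hN0]
    nlinarith
  rw [show meshOffset n N k + l + 1 = meshOffset n N k + (l + 1) by ring, e1, e2]
  push_cast at hl' ⊢
  have hl0 : 0 ≤ (l : ℝ) * (w / meshCount n N k) := by positivity
  exact ⟨k, hk, by linarith, by linarith, by linarith, by linarith⟩

theorem half_le_log (hN : 1 < N) : 1 / 2 ≤ Real.log N := by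
  have h : Real.log 2 ≤ Real.log N := Real.log_le_log (by norm_num) (by exact_mod_cast hN)
  linarith [Real.log_two_gt_d9]

/-- The properties of the mesh that the error analysis uses: every mesh interval is short, and it
lies outside the layer of a given scale or is short compared with this scale. -/
theorem mesh_interval (hn : 1 ≤ n) (hε : ∀ i, 0 < ε i) (hεm : Monotone ε) (hα : 0 < α)
    (hN : 1 < N) (hd : 2 ^ (n + 1) ∣ N) {j : ℕ} (hj : j < N) :
    0 ≤ meshPoint ε α N j ∧ meshPoint ε α N j < meshPoint ε α N (j + 1) ∧
      meshPoint ε α N (j + 1) ≤ 1 ∧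
      meshPoint ε α N (j + 1) - meshPoint ε α N j ≤ 2 ^ (n + 2) * ((N : ℝ)⁻¹ * Real.log N) ∧
      ∀ m, (√(ε m / α) * Real.log N ≤ meshPoint ε α N j ∨
          meshPoint ε α N (j + 1) - meshPoint ε α N j ≤
            √(ε m / α) * (2 ^ (n + 2) * ((N : ℝ)⁻¹ * Real.log N))) ∧
        (√(ε m / α) * Real.log N ≤ 1 - meshPoint ε α N (j + 1) ∨
          meshPoint ε α N (j + 1) - meshPoint ε α N j ≤
            √(ε m / α) * (2 ^ (n + 2) * ((N : ℝ)⁻¹ * Real.log N))) := by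
  obtain ⟨k, hk, h1, h2, h3, h4⟩ := exists_subinterval hn hε hα hN hd hj
  have hb0 := breakpoint_le hn hε hα hN (Nat.zero_le k) (by omega)
  rw [breakpoint_zero] at hb0
  have hb1 := breakpoint_le hn hε hα hN (show k + 1 ≤ 2 * n + 1 by omega) le_rfl
  rw [breakpoint_last] at hb1
  have hN0 : (0 : ℝ) < N := by exact_mod_cast (by omega)
  have hc : (0 : ℝ) ≤ 2 ^ (n + 1) / N := by positivity
  have hlog := half_le_log hN
  have hstep : ∀ t : ℝ, breakpoint ε α N (k + 1) - breakpoint ε α N k ≤ 2 * (t * Real.log N) →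
      meshPoint ε α N (j + 1) - meshPoint ε α N j ≤
        t * (2 ^ (n + 2) * ((N : ℝ)⁻¹ * Real.log N)) := by
    intro t ht
    refine h4.trans ((mul_le_mul_of_nonneg_left ht hc).trans_eq ?_)
    rw [div_eq_mul_inv]
    ring
  refine ⟨hb0.trans h1, h3, h2.trans hb1, ?_, fun m => ⟨?_, ?_⟩⟩
  -- No piece is wider than 1, and `1 ≤ 2 ln N`.
  · have := hstep 1 (by linarith)
    rwa [one_mul] at this
  · exact (scale_le_breakpoint_or_width_le hn hε hεm hα hN hk m).imp (fun h => h.trans h1)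
      (hstep _)
  · exact (scale_le_reflect_or_width_le hn hε hεm hα hN hk m).imp (fun h => by linarith)
      (hstep _)

end Mesh

section Convergence

/-! ### Error estimate -/

theorem exists_pos_le_of_continuousOn {ι : Type*} [Finite ι] {g : ι → ℝ → ℝ}
    (hg : ∀ i, ContinuousOn (g i) (Icc 0 1)) (hpos : ∀ i, ∀ x ∈ Icc (0 : ℝ) 1, 0 < g i x) :
    ∃ η > 0, ∀ i, ∀ x ∈ Icc (0 : ℝ) 1, η ≤ g i x := by
  choose y hy hmin using fun i =>
    isCompact_Icc.exists_isMinOn (nonempty_Icc.2 (zero_le_one' ℝ)) (hg i)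
  rcases isEmpty_or_nonempty ι with h | h
  · exact ⟨1, one_pos, fun i => (IsEmpty.false i).elim⟩
  · obtain ⟨i, hi⟩ := Finite.exists_min fun i => g i (y i)
    exact ⟨g i (y i), hpos i _ (hy i), fun j x hx => (hi j).trans (hmin j hx)⟩

theorem exists_bound_of_continuousOn {ι : Type*} [Fintype ι] {g : ι → ℝ → ℝ}
    (hg : ∀ i, ContinuousOn (g i) (Icc 0 1)) :
    ∃ C ≥ 0, ∀ i, ∀ x ∈ Icc (0 : ℝ) 1, |g i x| ≤ C := by
  choose c hc using fun i => isCompact_Icc.exists_bound_of_continuousOn (hg i)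
  refine ⟨∑ i, |c i|, Finset.sum_nonneg fun _ _ => abs_nonneg _, fun i x hx => ?_⟩
  exact (hc i x hx).trans ((le_abs_self _).trans
    (Finset.single_le_sum (f := fun i => |c i|) (fun _ _ => abs_nonneg _) (Finset.mem_univ i)))

theorem exists_lipschitz_of_contDiffOn {ι : Type*} [Fintype ι] {g : ι → ℝ → ℝ}
    (hg : ∀ i, ContDiffOn ℝ 2 (g i) (Icc 0 1)) :
    ∃ L ≥ 0, ∀ i, ∀ x ∈ Icc (0 : ℝ) 1, ∀ y ∈ Icc (0 : ℝ) 1, |g i x - g i y| ≤ L * |x - y| := by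
  choose c hc using fun i =>
    (hg i).exists_lipschitzOnWith (by norm_num) (convex_Icc 0 1) isCompact_Icc
  refine ⟨∑ i, (c i : ℝ), Finset.sum_nonneg fun _ _ => NNReal.coe_nonneg _,
    fun i x hx y hy => ?_⟩
  have h1 := (hc i).dist_le_mul x hx y hy
  rw [Real.dist_eq, Real.dist_eq] at h1
  exact h1.trans (mul_le_mul_of_nonneg_right (Finset.single_le_sum (f := fun i => (c i : ℝ))
    (fun _ _ => NNReal.coe_nonneg _) (Finset.mem_univ i)) (abs_nonneg _))

/-- Compactness turns the strict inequality for the row sums into a uniform gap `η`, the slack that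
the barrier spends. -/
theorem exists_coefficientBounds {n : ℕ} {A : ℝ → Matrix (Fin n) (Fin n) ℝ} {f : ℝ → Fin n → ℝ}
    {α : ℝ} (hA : ∀ i j, ContDiffOn ℝ 2 (fun x => A x i j) (Icc 0 1))
    (hf : ∀ i, ContDiffOn ℝ 2 (fun x => f x i) (Icc 0 1))
    (hoff : ∀ x ∈ Icc (0 : ℝ) 1, ∀ i j, i ≠ j → A x i j ≤ 0) (hα : 0 < α)
    (hrow : ∀ x ∈ Icc (0 : ℝ) 1, ∀ i, α < ∑ j, A x i j) :
    ∃ η a L F, CoefficientBounds A f α η a L F := by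
  obtain ⟨η, hη, h1⟩ := exists_pos_le_of_continuousOn (g := fun i x => ∑ j, A x i j - α)
    (fun i => (continuousOn_finsetSum _ fun j _ => (hA i j).continuousOn).sub continuousOn_const)
    (fun i x hx => sub_pos.2 (hrow x hx i))
  obtain ⟨a, ha, h2⟩ := exists_bound_of_continuousOn (g := fun i x => A x i i)
    (fun i => (hA i i).continuousOn)
  obtain ⟨F, hF, h3⟩ := exists_bound_of_continuousOn (g := fun i x => f x i)
    (fun i => (hf i).continuousOn)
  obtain ⟨L₁, hL₁, h4⟩ := exists_lipschitz_of_contDiffOn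
    (g := fun (p : Fin n × Fin n) x => A x p.1 p.2) (fun p => hA p.1 p.2)
  obtain ⟨L₂, hL₂, h5⟩ := exists_lipschitz_of_contDiffOn (g := fun i x => f x i) hf
  exact ⟨η, a, L₁ + L₂, F,
    { off := hoff
      row := fun x hx i => by linarith [h1 i x hx]
      diag := fun x hx i => (le_abs_self _).trans (h2 i x hx)
      lipA := fun x hx y hy i j => (h4 (i, j) x hx y hy).trans
        (mul_le_mul_of_nonneg_right (by linarith) (abs_nonneg _))
      lipf := fun x hx y hy i => (h5 i x hx y hy).trans
        (mul_le_mul_of_nonneg_right (by linarith) (abs_nonneg _))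
      bddf := fun x hx i => h3 i x hx
      α_pos := hα
      η_pos := hη
      a_nonneg := ha
      L_nonneg := by linarith
      F_nonneg := hF }⟩

theorem IsSolution.isClassical {n : ℕ} {ε : Fin n → ℝ} {A : ℝ → Matrix (Fin n) (Fin n) ℝ}
    {f : ℝ → Fin n → ℝ} {u₀ u₁ : Fin n → ℝ} {u : ℝ → Fin n → ℝ} {α : ℝ} (hα : 0 < α)
    (hε : ∀ i, 0 < ε i) (hε1 : ∀ i, ε i ≤ 1) (hεm : Monotone ε)
    (hu : IsSolution ε A f u₀ u₁ u) :
    IsClassical A f α (fun i => √(ε i / α)) (fun i x => u x i) (fun i => deriv fun x => u x i)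
      (fun i => deriv (deriv fun x => u x i)) := by
  have hsq : ∀ i, α * √(ε i / α) ^ 2 = ε i := by
    intro i
    rw [Real.sq_sqrt (div_pos (hε i) hα).le]
    field_simp
  have hC : ∀ i, ContDiffOn ℝ 2 (fun x => u x i) (Ioo 0 1) := contDiffOn_pi.1 hu.contDiffOn
  have hC' : ∀ i, ContDiffOn ℝ 1 (deriv fun x => u x i) (Ioo 0 1) := fun i =>
    (hC i).deriv_of_isOpen isOpen_Ioo (by norm_num)
  refine ⟨fun i => (continuousOn_pi.1 hu.continuousOn) i, fun i x hx => ?_, fun i x hx => ?_,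
    fun x hx i => ?_, fun i => Real.sqrt_pos.2 (div_pos (hε i) hα), fun i j hij => ?_,
    fun i => (hsq i).trans_le (hε1 i)⟩
  · exact (((hC i).differentiableOn (by norm_num)).differentiableAt
      (isOpen_Ioo.mem_nhds hx)).hasDerivAt
  · exact (((hC' i).differentiableOn (by norm_num)).differentiableAt
      (isOpen_Ioo.mem_nhds hx)).hasDerivAt
  · have h := hu.eqn x hx i
    rw [iteratedDeriv_succ, iteratedDeriv_one] at h
    rw [hsq]
    exact h
  · exact Real.sqrt_le_sqrt ((div_le_div_iff_of_pos_right hα).2 (hεm hij))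

/-- Far from the endpoint the first exponential is already at most `δ`; otherwise `1 - exp(-t) ≤ t`
with `t = (y - x) / s ≤ δ`. -/
theorem exp_sub_exp_le {s x y b δ : ℝ} (hs : 0 < s) (hx : 0 ≤ x) (hxy : x ≤ y)
    (hb : Real.exp (-b) ≤ δ) (h : s * b ≤ x ∨ y - x ≤ s * δ) :
    Real.exp (-x / s) - Real.exp (-y / s) ≤ δ := by
  rcases h with h | h
  · have h1 : Real.exp (-x / s) ≤ Real.exp (-b) := by
      rw [Real.exp_le_exp, neg_div, neg_le_neg_iff, le_div_iff₀ hs]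
      linarith
    linarith [Real.exp_nonneg (-y / s)]
  · have h1 : Real.exp (-y / s) = Real.exp (-x / s) * Real.exp (-((y - x) / s)) := by
      rw [← Real.exp_add]
      congr 1
      ring
    have h2 : 1 - (y - x) / s ≤ Real.exp (-((y - x) / s)) := by
      linarith [Real.add_one_le_exp (-((y - x) / s))]
    have h3 : Real.exp (-x / s) ≤ 1 := by
      rw [Real.exp_le_one_iff, neg_div]
      exact neg_nonpos.2 (by positivity)
    have h4 : (y - x) / s ≤ δ := by
      rw [div_le_iff₀ hs]
      linarith
    have h5 : 0 ≤ (y - x) / s := div_nonneg (by linarith) hs.le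
    have h6 := Real.exp_nonneg (-x / s)
    rw [h1]
    nlinarith

variable {n : ℕ} {A : ℝ → Matrix (Fin n) (Fin n) ℝ} {f : ℝ → Fin n → ℝ} {α η a L F : ℝ}
  {s : Fin n → ℝ} {u u₁ u₂ : Fin n → ℝ → ℝ}

/-- The oscillation of the solution over an interval that resolves the layers. -/
theorem IsClassical.oscillation_le (hu : IsClassical A f α s u u₁ u₂) {D : ℝ} {K : Fin n → ℝ}
    (hD : ∀ i, ∀ x ∈ Ioo (0 : ℝ) 1, |u₁ i x| ≤ D + ∑ m, K m / s m * layer (s m) 1 x)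
    (hD0 : 0 ≤ D) (hK : ∀ m, 0 ≤ K m) {p q b δ : ℝ} (hp : 0 ≤ p) (hq : q ≤ 1) (hpq : q - p ≤ δ)
    (hb : Real.exp (-b) ≤ δ)
    (h : ∀ m, (s m * b ≤ p ∨ q - p ≤ s m * δ) ∧ (s m * b ≤ 1 - q ∨ q - p ≤ s m * δ))
    {x y : ℝ} (hx : x ∈ Icc p q) (hy : y ∈ Icc p q) (i : Fin n) :
    |u i y - u i x| ≤ (D + ∑ m, 2 * K m) * δ := by
  wlog hxy : x ≤ y generalizing x y
  · rw [abs_sub_comm]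
    exact this hy hx (le_of_not_ge hxy)
  refine (hu.abs_sub_le hD (hp.trans hx.1) hxy (hy.2.trans hq) i).trans ?_
  rw [add_mul, Finset.sum_mul]
  refine add_le_add (mul_le_mul_of_nonneg_left (by linarith [hx.1, hy.2]) hD0)
    (Finset.sum_le_sum fun m _ => ?_)
  have h1 := exp_sub_exp_le (hu.s_pos m) (hp.trans hx.1) hxy hb
    ((h m).1.imp (fun h => h.trans hx.1) fun h => by linarith [hx.1, hy.2])
  have h2 := exp_sub_exp_le (x := 1 - y) (y := 1 - x) (hu.s_pos m) (by linarith [hy.2])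
    (by linarith) hb
    ((h m).2.imp (fun h => by linarith [hy.2]) fun h => by linarith [hx.1, hy.2])
  calc _ ≤ K m * (δ + δ) := mul_le_mul_of_nonneg_left (add_le_add h1 h2) (hK m)
    _ = _ := by ring

/-- The truncation error is the oscillation of the reaction term. -/
theorem IsClassical.abs_reaction_sub_le (hu : IsClassical A f α s u u₁ u₂)
    (hB : CoefficientBounds A f α η a L F) {c P δ : ℝ}
    (hc : ∀ i, ∀ x ∈ Icc (0 : ℝ) 1, |u i x| ≤ c) {x ξ : ℝ} (hx : x ∈ Ioo (0 : ℝ) 1)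
    (hξ : ξ ∈ Ioo (0 : ℝ) 1) (hxξ : |ξ - x| ≤ δ) (hosc : ∀ i, |u i ξ - u i x| ≤ P * δ)
    (i : Fin n) :
    |α * s i ^ 2 * u₂ i ξ - α * s i ^ 2 * u₂ i x| ≤ (n * c * L + 2 * a * P + L) * δ := by
  have hx' := Ioo_subset_Icc_self hx
  have hξ' := Ioo_subset_Icc_self hξ
  have hc0 : 0 ≤ c := (abs_nonneg _).trans (hc i x hx')
  have hL := hB.L_nonneg
  have e : α * s i ^ 2 * u₂ i ξ - α * s i ^ 2 * u₂ i x =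
      (∑ j, (A ξ i j - A x i j) * u j ξ + ∑ j, A x i j * (u j ξ - u j x)) -
        (f ξ i - f x i) := by
    rw [← hu.eqn x hx i, ← hu.eqn ξ hξ i]
    simp only [mul_sub, sub_mul, Finset.sum_sub_distrib]
    ring
  have h1 := hB.abs_sum_sub_mul_le hξ' hx' i (w := fun j => u j ξ) fun j => hc j ξ hξ'
  have h2 := hB.abs_sum_mul_le hx' i hosc
  have h3 := hB.lipf ξ hξ' x hx' i
  have h4 : n * c * L * |ξ - x| ≤ n * c * L * δ := by gcongr
  have h5 : L * |ξ - x| ≤ L * δ := by gcongr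
  rw [e]
  refine (abs_sub _ _).trans ((add_le_add (abs_add_le _ _) le_rfl).trans ?_)
  linarith

end Convergence

end ReactionDiffusion

end

/-! ### The parameter-uniform error bound -/

theorem mainTheorem1 (n : ℕ) (hn : 1 ≤ n)
    (A : ℝ → Matrix (Fin n) (Fin n) ℝ) (f : ℝ → Fin n → ℝ) (u₀ u₁ : Fin n → ℝ) (α : ℝ)
    (hA : ∀ i j, ContDiffOn ℝ 2 (fun x => A x i j) (Set.Icc 0 1))
    (hf : ∀ i, ContDiffOn ℝ 2 (fun x => f x i) (Set.Icc 0 1))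
    (hdom : ∀ x ∈ Set.Icc (0 : ℝ) 1, ∀ i, ∑ j ∈ Finset.univ.erase i, |A x i j| < A x i i)
    (hoff : ∀ x ∈ Set.Icc (0 : ℝ) 1, ∀ i j, i ≠ j → A x i j ≤ 0)
    (hα : 0 < α)
    (hrow : ∀ x ∈ Set.Icc (0 : ℝ) 1, ∀ i, α < ∑ j, A x i j) :
    ∃ C : ℝ, 0 < C ∧
      ∀ ε : Fin n → ℝ, (∀ i, 0 < ε i) → (∀ i, ε i ≤ 1) → StrictMono ε →
      ∀ N : ℕ, 1 < N → 2 ^ (n + 1) ∣ N →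
      ∀ u : ℝ → Fin n → ℝ, ReactionDiffusion.IsSolution ε A f u₀ u₁ u →
      ∀ U : ℕ → Fin n → ℝ, ReactionDiffusion.IsDiscreteSolution ε A f u₀ u₁ N
        (ReactionDiffusion.meshPoint ε α N) U →
      ∀ j ≤ N,
        ‖U j - u (ReactionDiffusion.meshPoint ε α N j)‖ ≤ C * (N : ℝ)⁻¹ * Real.log N := by
  open ReactionDiffusion in
  obtain ⟨η, a, L, F, hB⟩ := exists_coefficientBounds hA hf hoff hα hrow
  have hη := hB.η_pos
  have ha := hB.a_nonneg
  have hL := hB.L_nonneg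
  have hF := hB.F_nonneg
  obtain ⟨c, hcdef⟩ : ∃ c, c = ‖u₀‖ + ‖u₁‖ + F / α := ⟨_, rfl⟩
  have hc0 : 0 ≤ c := by rw [hcdef]; positivity
  obtain ⟨d, hddef⟩ : ∃ d, d = (4 * c + F + 2 * a * c) / √α := ⟨_, rfl⟩
  have hd0 : 0 ≤ d := by rw [hddef]; positivity
  -- Adding the two required ratios makes one family of weights serve both `hK₁` and `hK₂`.
  obtain ⟨K, hK, hKQ⟩ := exists_weights n
    (show 0 ≤ a / α + a * (a / α) / η by positivity)
  have hKsum : ∀ i, 0 ≤ ∑ m ∈ Finset.Iio i, K m := fun i =>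
    Finset.sum_nonneg fun m _ => (hK m).le
  have hK₁ : ∀ i, 1 + a / α * ∑ m ∈ Finset.Iio i, K m ≤ K i := by
    intro i
    have h1 : 0 ≤ a * (a / α) / η * ∑ m ∈ Finset.Iio i, K m :=
      mul_nonneg (by positivity) (hKsum i)
    linarith [hKQ i]
  have hK₂ : ∀ i, a * (a / α) * ∑ m ∈ Finset.Iio i, K m ≤ η * K i := by
    intro i
    have h1 : 0 ≤ a / α * ∑ m ∈ Finset.Iio i, K m := mul_nonneg (by positivity) (hKsum i)
    calc a * (a / α) * ∑ m ∈ Finset.Iio i, K m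
        = η * (a * (a / α) / η * ∑ m ∈ Finset.Iio i, K m) := by field_simp
      _ ≤ η * K i := mul_le_mul_of_nonneg_left (by linarith [hKQ i]) hη.le
  obtain ⟨D, hDdef⟩ : ∃ D, D = L * (1 + n * c) / α := ⟨_, rfl⟩
  have hD0 : 0 ≤ D := by rw [hDdef]; positivity
  obtain ⟨P, hPdef⟩ : ∃ P, P = D + ∑ m, 2 * (d * K m) := ⟨_, rfl⟩
  have hP0 : 0 ≤ P := by
    rw [hPdef]
    exact add_nonneg hD0 (Finset.sum_nonneg fun m _ => by have := hK m; positivity)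
  obtain ⟨B, hBdef⟩ : ∃ B, B = n * c * L + 2 * a * P + L := ⟨_, rfl⟩
  have hB0 : 0 ≤ B := by rw [hBdef]; positivity
  -- `B * δ / α` is the stability bound with `δ` the mesh width bound; the `+ 1` only secures
  -- positivity, as `B` may vanish.
  refine ⟨B * 2 ^ (n + 2) / α + 1, by positivity, ?_⟩
  intro ε hε hε1 hεs N hN hdvd u hu U hU
  have hcl := hu.isClassical hα hε hε1 hεs.monotone
  have hbd : ∀ i, ∀ x ∈ Set.Icc (0 : ℝ) 1, |u x i| ≤ c := by
    intro i x hx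
    rw [hcdef]
    refine hcl.abs_le hB (fun i => ?_) (fun i => ?_) i hx
    · simp only [hu.left]
      linarith [norm_le_pi_norm u₀ i, norm_nonneg u₁, Real.norm_eq_abs (u₀ i)]
    · simp only [hu.right]
      linarith [norm_le_pi_norm u₁ i, norm_nonneg u₀, Real.norm_eq_abs (u₁ i)]
  have hD := fun i x (hx : x ∈ Set.Ioo (0 : ℝ) 1) => hcl.abs_deriv_le_layer hB hbd hc0 hd0
    (fun i x hx => hddef ▸ hcl.abs_deriv_le hB hbd i hx) hK hK₁ hK₂ i hx
  -- Absorbs `d` into the weights, so the oscillation bound is used with `d * K m`.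
  simp only [Finset.mul_sum, ← mul_assoc, ← mul_div_assoc, ← hDdef] at hD
  have hN0 : (0 : ℝ) < N := by exact_mod_cast (by omega)
  have hlog := half_le_log hN
  obtain ⟨δ, hδ⟩ : ∃ δ, δ = 2 ^ (n + 2) * ((N : ℝ)⁻¹ * Real.log N) := ⟨_, rfl⟩
  have hδ0 : 0 ≤ δ := by rw [hδ]; positivity
  have hexp : Real.exp (-Real.log N) ≤ δ := by
    rw [Real.exp_neg, Real.exp_log hN0, hδ]
    have h1 : (2 : ℝ) ≤ 2 ^ (n + 2) := by
      calc (2 : ℝ) = 2 ^ 1 := by norm_num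
        _ ≤ 2 ^ (n + 2) := pow_le_pow_right₀ (by norm_num) (by omega)
    have h2 : (1 : ℝ) ≤ 2 ^ (n + 2) * Real.log N := by nlinarith
    calc (N : ℝ)⁻¹ = (N : ℝ)⁻¹ * 1 := by ring
      _ ≤ (N : ℝ)⁻¹ * (2 ^ (n + 2) * Real.log N) := by gcongr
      _ = _ := by ring
  set x := meshPoint ε α N with hxdef
  have hmesh := fun j (hj : j < N) => mesh_interval hn hε hεs.monotone hα hN hdvd hj
  simp only [← hδ, ← hxdef] at hmesh
  have hosc : ∀ j < N, ∀ y ∈ Set.Icc (x j) (x (j + 1)), ∀ z ∈ Set.Icc (x j) (x (j + 1)),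
      ∀ i, |u z i - u y i| ≤ P * δ := by
    intro j hj y hy z hz i
    obtain ⟨h1, h2, h3, h4, h5⟩ := hmesh j hj
    rw [hPdef]
    exact hcl.oscillation_le hD hD0 (fun m => mul_nonneg hd0 (hK m).le) h1 h3 h4 hexp h5 hy hz i
  have hx0 : x 0 = 0 := meshPoint_zero hN hdvd
  have hxN : x N = 1 := meshPoint_last hn hN hdvd
  have hsq : ∀ i, α * √(ε i / α) ^ 2 = ε i := by
    intro i
    rw [Real.sq_sqrt (div_pos (hε i) hα).le]
    field_simp
  have hmem : ∀ j, 0 < j → j < N → x j ∈ Set.Ioo (0 : ℝ) 1 := by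
    intro j hj hj'
    have h1 := hmesh (j - 1) (by omega)
    rw [Nat.sub_add_cancel hj] at h1
    have h2 := hmesh j hj'
    exact ⟨h1.1.trans_lt h1.2.1, h2.2.1.trans_le h2.2.2.1⟩
  have hstab := discrete_stability hε (fun j hj => (hmesh j hj).2.1) (M := fun j => A (x j))
    hα (mul_nonneg hB0 hδ0) (fun k hk hk' => hoff _ (Set.Ioo_subset_Icc_self (hmem k hk hk')))
    (fun k hk hk' i => (hrow _ (Set.Ioo_subset_Icc_self (hmem k hk hk')) i).le)
    (e := fun j i => U j i - u (x j) i)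
    (by ext i; simp [hx0, hU.left, hu.left]) (by ext i; simp [hxN, hU.right, hu.right])
    (fun k hk hk' i => ?_)
  · intro j hj
    rw [pi_norm_le_iff_of_nonneg (by positivity)]
    intro i
    refine (hstab j hj i).trans ?_
    rw [hδ]
    have : 0 ≤ (N : ℝ)⁻¹ * Real.log N := by positivity
    calc _ = B * 2 ^ (n + 2) / α * ((N : ℝ)⁻¹ * Real.log N) := by ring
      _ ≤ (B * 2 ^ (n + 2) / α + 1) * ((N : ℝ)⁻¹ * Real.log N) := by linarith
      _ = _ := by ring
  · have hl := hmesh (k - 1) (by omega)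
    have hr := hmesh k hk'
    have hoscl := hosc (k - 1) (by omega)
    rw [Nat.sub_add_cancel hk] at hl hoscl
    obtain ⟨ξ, hξ, hdiv⟩ := exists_divided_difference_eq hl.2.1 hr.2.1
      ((hcl.cont i).mono (Set.Icc_subset_Icc hl.1 hr.2.2.1))
      (fun y hy => hcl.deriv₁ i y ⟨hl.1.trans_lt hy.1, hy.2.trans_le hr.2.2.1⟩)
      (fun y hy => hcl.deriv₂ i y ⟨hl.1.trans_lt hy.1, hy.2.trans_le hr.2.2.1⟩)
    have hξ' : ξ ∈ Set.Ioo (0 : ℝ) 1 := ⟨hl.1.trans_lt hξ.1, hξ.2.trans_le hr.2.2.1⟩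
    -- `ξ` may lie in either adjacent cell; both contain `x k`, so one cell's oscillation suffices.
    have hcell : |ξ - x k| ≤ δ ∧ ∀ i, |u ξ i - u (x k) i| ≤ P * δ := by
      rcases le_total ξ (x k) with h | h
      · exact ⟨abs_le.2 ⟨by linarith [hξ.1, hl.2.2.2.1], by linarith⟩,
          hoscl _ ⟨hl.2.1.le, le_rfl⟩ _ ⟨hξ.1.le, h⟩⟩
      · exact ⟨abs_le.2 ⟨by linarith, by linarith [hξ.2, hr.2.2.2.1]⟩,
          hosc k hk' _ ⟨le_rfl, hr.2.1.le⟩ _ ⟨h, hξ.2.le⟩⟩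
    have htr := hcl.abs_reaction_sub_le hB hbd (hmem k hk hk') hξ' hcell.1 hcell.2 i
    have heq := hU.eqn k hk hk' i
    have hsol := hcl.eqn (x k) (hmem k hk hk') i
    have hsd : secondDiff x (fun l => U l i - u (x l) i) k =
        secondDiff x (fun l => U l i) k - deriv (deriv fun y => u y i) ξ := by
      rw [← hdiv]
      simp only [secondDiff]
      ring
    simp only [Matrix.mulVec, dotProduct] at heq
    rw [hBdef]
    refine le_of_eq_of_le (congrArg abs ?_) htr
    rw [hsd]
    simp only [mul_sub, Finset.sum_sub_distrib]
    simp only [hsq] at hsol ⊢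
    linarith
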